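/- Theorem (lower bound for reward-free learning of Markov games). Consider tabular episodic two-player zero-sum Markov games with $H$ steps, $S$ states, a fixed initial state $s_1$, $A$ actions of the max-player and $B$ actions of the min-player, with transition laws $\mathbb{P}_h(\cdot\mid s,a,b)$ and with reward laws on $[0,1]$ whose expectations are $r_h(s,a,b)$. For policies $\mu,\nu$ of the two players (which may depend on the state and on the past of the episode), let $V_1^{\mu,\nu}(s_1)$ be the expected sum of the rewards $r_h(s_h,a_h,b_h)$, $1\le h\le H$, over one episode that starts in $s_1$, and put $V_1^{\dagger,\nu}(s_1)=\sup_{\mu'}V_1^{\mu',\nu}(s_1)$ and $V_1^{\mu,\dagger}(s_1)=\inf_{\nu'}V_1^{\mu,\nu'}(s_1)$. A reward-free algorithm with $K$ episodes first explores: in each episode $k\le K$ it plays a (possibly randomized and correlated) joint policy chosen from the transitions observed so far, without seeing any reward. Then its data set $\{(s_{k,h},a_{k,h},b_{k,h},s_{k,h+1})\}_{k\le K,\,h\le H}$ is augmented with rewards $r_{k,h}$ drawn independently from the reward laws at $(h,s_{k,h},a_{k,h},b_{k,h})$, and from these data it outputs, possibly at random, a pair of policies $(\hat\mu,\hat\nu)$.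 There is an absolute constant $c>0$ such that for all $H,S,A,B\ge1$ with $AB\ge 2$ and with $H\ge 2$ or $H=S=1$, for every initial state $s_1$ and every $\epsilon\in(0,c]$, there is a family $\mathfrak{M}(\epsilon)$ of such Markov games with the following property: for every $K$ with $K\le cH^2SAB/\epsilon^2$ and every reward-free algorithm using $K$ episodes there is a game $\mathcal{M}\in\mathfrak{M}(\epsilon)$ such that, if the algorithm is run on $\mathcal{M}$ and outputs $(\hat\mu,\hat\nu)$, then with probability at least $1/4$ $$V_1^{\dagger,\hat\nu}(s_1)-V_1^{\hat\mu,\dagger}(s_1)\ \ge\ \epsilon .$$ -/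

import Mathlib

open MeasureTheory ProbabilityTheory

noncomputable section

/-- A tabular episodic two-player zero-sum Markov game with `H` steps, `S` states, `A` actions of
the max-player and `B` actions of the min-player: a transition law for every step, state and
action pair, and a reward law on `[0,1]` for every step, state and action pair. (Step `h` of the
literature, `1 ≤ h ≤ H`, is the index `h - 1 : Fin H`.) -/
structure MarkovGame (H S A B : ℕ) where
  /-- `trans h s a b s'` is the probability of moving to `s'` from `s` under `(a, b)` at step `h`. -/
  trans : Fin H → Fin S → Fin A → Fin B → stdSimplex ℝ (Fin S)
  /-- `reward h s a b` is the law of the reward of `(a, b)` in state `s` at step `h`. -/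
  reward : Fin H → Fin S → Fin A → Fin B → ProbabilityMeasure (Set.Icc (0 : ℝ) 1)

/-- The reward function `r_h(s, a, b)`: the expectation of the reward law. -/
def meanReward {H S A B : ℕ} (G : MarkovGame H S A B)
    (h : Fin H) (s : Fin S) (a : Fin A) (b : Fin B) : ℝ :=
  ∫ x, (x : ℝ) ∂(G.reward h s a b : Measure (Set.Icc (0 : ℝ) 1))

/-- The transitions of one episode: the states `s_1, …, s_{H+1}` and the action pairs
`(a_1, b_1), …, (a_H, b_H)`. No reward is recorded. -/
abbrev Episode (H S A B : ℕ) : Type :=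
  (Fin (H + 1) → Fin S) × (Fin H → Fin A × Fin B)

/-- What has happened in an episode during its first `n` steps. -/
abbrev Past (S A B n : ℕ) : Type := Fin n → Fin S × Fin A × Fin B

/-- The part of an episode before step `h`. -/
def pastOf {H S A B : ℕ} (τ : Episode H S A B) (h : Fin H) : Past S A B h :=
  fun i => (τ.1 ⟨i, by omega⟩, τ.2 ⟨i, by omega⟩)

/-- A (possibly history-dependent) policy of the max-player: a distribution over the actions for
every step, past of the episode and current state. Markov policies are those that ignore the
past. -/
abbrev MaxPolicy (H S A B : ℕ) : Type :=
  (h : Fin H) → Past S A B h → Fin S → stdSimplex ℝ (Fin A)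

/-- A (possibly history-dependent) policy of the min-player. -/
abbrev MinPolicy (H S A B : ℕ) : Type :=
  (h : Fin H) → Past S A B h → Fin S → stdSimplex ℝ (Fin B)

/-- A joint, possibly correlated, policy of both players. -/
abbrev JointPolicy (H S A B : ℕ) : Type :=
  (h : Fin H) → Past S A B h → Fin S → stdSimplex ℝ (Fin A × Fin B)

/-- The players draw their actions independently of each other. -/
def prodPolicy {H S A B : ℕ} (μ : MaxPolicy H S A B) (ν : MinPolicy H S A B) :
    JointPolicy H S A B :=
  fun h p s => ⟨fun ab => (μ h p s).1 ab.1 * (ν h p s).1 ab.2,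
    fun ab => mul_nonneg ((μ h p s).2.1 ab.1) ((ν h p s).2.1 ab.2), by
      rw [Fintype.sum_prod_type]
      simp only [← Finset.mul_sum, (ν h p s).2.2, mul_one, (μ h p s).2.2]⟩

/-- The probability that the episode `τ` occurs when the joint policy `π` is played from the
initial state `s₁`. -/
def episodeProb {H S A B : ℕ} (G : MarkovGame H S A B) (s₁ : Fin S) (π : JointPolicy H S A B)
    (τ : Episode H S A B) : ℝ :=
  (if τ.1 0 = s₁ then 1 else 0) *
    ∏ h : Fin H, ((π h (pastOf τ h) (τ.1 h.castSucc)).1 (τ.2 h) *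
      (G.trans h (τ.1 h.castSucc) (τ.2 h).1 (τ.2 h).2).1 (τ.1 h.succ))

/-- The value `V_1^{μ, ν}(s₁)`: the expected cumulative reward over one episode. -/
def value {H S A B : ℕ} (G : MarkovGame H S A B) (s₁ : Fin S)
    (μ : MaxPolicy H S A B) (ν : MinPolicy H S A B) : ℝ :=
  ∑ τ : Episode H S A B, episodeProb G s₁ (prodPolicy μ ν) τ *
    ∑ h : Fin H, meanReward G h (τ.1 h.castSucc) (τ.2 h).1 (τ.2 h).2

/-- The duality gap `V_1^{†, ν}(s₁) - V_1^{μ, †}(s₁)`. All values lie in `[0, H]`, so that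
supremum and infimum are genuine as soon as both action sets are nonempty. -/
def dualityGap {H S A B : ℕ} (G : MarkovGame H S A B) (s₁ : Fin S)
    (μ : MaxPolicy H S A B) (ν : MinPolicy H S A B) : ℝ :=
  (⨆ μ' : MaxPolicy H S A B, value G s₁ μ' ν) - ⨅ ν' : MinPolicy H S A B, value G s₁ μ ν'

/-- A (randomized) reward-free algorithm that uses `K` episodes. In the exploration phase it chooses
the joint policy of the `k`-th episode from the transitions of the earlier episodes, without any
reward. In the planning phase it receives all transitions, augmented with one reward for every
episode and step, and draws a pair of policies. -/
structure RewardFreeAlgorithm (K H S A B : ℕ) where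
  explore : (k : Fin K) → (Fin k → Episode H S A B) → JointPolicy H S A B
  plan : (Fin K → Episode H S A B) →
    Kernel (Fin K × Fin H → Set.Icc (0 : ℝ) 1) (MaxPolicy H S A B × MinPolicy H S A B)
  plan_markov : ∀ D, IsMarkovKernel (plan D)

/-- The probability that the exploration phase collects the transitions `D`. -/
def datasetProb {K H S A B : ℕ} (G : MarkovGame H S A B) (s₁ : Fin S)
    (alg : RewardFreeAlgorithm K H S A B) (D : Fin K → Episode H S A B) : ℝ :=
  ∏ k : Fin K, episodeProb G s₁ (alg.explore k (fun j => D ⟨j, by omega⟩)) (D k)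

/-- The law of the rewards with which the transitions `D` are augmented: independent samples from
the reward laws of the visited state-action pairs. -/
def rewardLaw {K H S A B : ℕ} (G : MarkovGame H S A B) (D : Fin K → Episode H S A B) :
    Measure (Fin K × Fin H → Set.Icc (0 : ℝ) 1) :=
  Measure.pi fun kh =>
    (G.reward kh.2 ((D kh.1).1 kh.2.castSucc) ((D kh.1).2 kh.2).1 ((D kh.1).2 kh.2).2 :
      Measure (Set.Icc (0 : ℝ) 1))

/-- The law of the pair of policies that the algorithm outputs when it is run on `G`. -/
def outputLaw {K H S A B : ℕ} (G : MarkovGame H S A B) (s₁ : Fin S)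
    (alg : RewardFreeAlgorithm K H S A B) : Measure (MaxPolicy H S A B × MinPolicy H S A B) :=
  ∑ D : Fin K → Episode H S A B,
    ENNReal.ofReal (datasetProb G s₁ alg D) • (rewardLaw G D).bind (alg.plan D)

end

/-! The hard games have uniform transitions, so no policy influences which states are visited. If `2
≤ A`, every step and state hides an arm of the max-player and a context of the min-player. Outside
the context the mean reward is `1`. Inside it is `1 / 2`, raised by `d` at the arm. Playing the arms
guarantees `H * (1 / 2 + d)`, while a min-player who plays the contexts holds `μ` down to `1 / 2`
wherever it misses the arm. The duality gap is therefore at least `d` times the expected number of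
misses. If `A = 1`, then `2 ≤ B`, and the players exchange roles with the bonus `-d` and the outside
reward `0`. Exploration sees no rewards, so the law of the transitions is the same in all these
games. For a step at which the state is uniform, the pair (arm, context) at a given state is visited
`K / (S * A * B)` times on average over the hidden data. Removing the bonus at that one place is a
chi-square change of measure whose cost is controlled by `d ^ 2` times this number
(`sum_prod_bernoulliWeight_mul_le`). Afterwards the rewards carry no information on that arm, so a
guess succeeds with probability at most `1 / 2`. In total the output plays the arm with average
probability at most `1 / 2 + 1 / 16 + 1 / 16 = 5 / 8` (`sum_sum_dataExpectation_le`). Averaging over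
steps, states and hidden data, and a reverse Markov inequality, give one game in which at least an
eighth of the uniform steps is missed with probability `1 / 4` (`exists_plantedGame`). The guess may
know the contexts, and it must: misses are counted against the opponent who plays them. -/

/-! ### Sums over sequences and functions -/

/-- Sequential sums: if each factor, given its past, sums to `c k`, then the product sums to
`∏ k, c k`. -/
theorem sum_prod_sequential {X : Type*} [Fintype X] [DecidableEq X] :
    ∀ (n : ℕ) (f : (k : Fin n) → (Fin k → X) → X → ℝ) (c : Fin n → ℝ),
      (∀ k d, ∑ x, f k d x = c k) →
        ∑ D : Fin n → X, ∏ k : Fin n, f k (fun j => D ⟨j, by omega⟩) (D k) = ∏ k, c k := by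
  intro n
  induction n with
  | zero => intro f c _; simp
  | succ n ih =>
    intro f c hf
    rw [← (Fin.snocEquiv (fun _ : Fin (n + 1) => X)).sum_comp, Fintype.sum_prod_type,
      Finset.sum_comm, Fin.prod_univ_castSucc,
      ← ih (fun k => f k.castSucc) (fun k => c k.castSucc) (fun k d => hf k.castSucc d),
      Finset.sum_mul]
    refine Finset.sum_congr rfl fun D _ => ?_
    rw [← hf (Fin.last n) D, Finset.mul_sum]
    refine Finset.sum_congr rfl fun x _ => ?_
    rw [Fin.prod_univ_castSucc]
    have hs : ∀ i : Fin n, (Fin.snocEquiv (fun _ : Fin (n + 1) => X)) (x, D) i.castSucc = D i :=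
      fun i => Fin.snoc_castSucc (α := fun _ => X) x D i
    have hl : (Fin.snocEquiv (fun _ : Fin (n + 1) => X)) (x, D) (Fin.last n) = x :=
      Fin.snoc_last (α := fun _ => X) x D
    congr 1
    · refine Finset.prod_congr rfl fun k _ => ?_
      rw [hs k]
      congr 1
      funext j
      exact hs ⟨j, by have := j.2; have := k.2; simp at *; omega⟩
    · rw [hl]
      congr 1
      funext j
      exact hs ⟨j, j.2⟩

/-- Resampling one coordinate of a function does not change a sum over all functions. -/
theorem card_mul_sum_eq_sum_sum_update {ι α : Type*} [Fintype ι] [DecidableEq ι] [Fintype α]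
    (i : ι) (F : (ι → α) → ℝ) :
    (Fintype.card α : ℝ) * ∑ f, F f = ∑ f, ∑ a, F (Function.update f i a) := by
  -- Exchanging the value at `i` with the spare value is an involution.
  let e : (ι → α) × α ≃ (ι → α) × α :=
    { toFun := fun p => (Function.update p.1 i p.2, p.1 i)
      invFun := fun p => (Function.update p.1 i p.2, p.1 i)
      left_inv := fun p => by simp
      right_inv := fun p => by simp }
  have h := e.sum_comp (fun p : (ι → α) × α => F p.1)
  rw [Fintype.sum_prod_type, Fintype.sum_prod_type] at h
  simp only [e, Equiv.coe_fn_mk] at h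
  rw [h, Finset.mul_sum]
  simp

theorem card_mul_sum_eval {ι α : Type*} [Fintype ι] [DecidableEq ι] [Fintype α]
    (i : ι) (F : α → ℝ) :
    (Fintype.card α : ℝ) * ∑ f : ι → α, F (f i) = (Fintype.card (ι → α) : ℝ) * ∑ a, F a := by
  rw [card_mul_sum_eq_sum_sum_update i (fun f => F (f i))]
  simp

/-! ### Change of measure for products of Bernoulli laws -/

/-- The weights of the Bernoulli law with mean `q`. -/
noncomputable def bernoulliWeight (q : ℝ) (x : Bool) : ℝ := if x then q else 1 - q

theorem bernoulliWeight_nonneg {q : ℝ} (h0 : 0 ≤ q) (h1 : q ≤ 1) (x : Bool) :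
    0 ≤ bernoulliWeight q x := by
  cases x <;> simp [bernoulliWeight, h0, h1]

theorem sum_bernoulliWeight (q : ℝ) : ∑ x, bernoulliWeight q x = 1 := by
  simp [bernoulliWeight]

theorem sum_prod_bool {ι : Type*} [Fintype ι] [DecidableEq ι] (f : ι → Bool → ℝ) :
    ∑ x : ι → Bool, ∏ i, f i (x i) = ∏ i, ∑ b, f i b :=
  (Fintype.prod_sum f).symm

theorem sum_prod_bernoulliWeight {ι : Type*} [Fintype ι] [DecidableEq ι] (u : ι → ℝ) :
    ∑ x : ι → Bool, ∏ i, bernoulliWeight (u i) (x i) = 1 := by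
  rw [sum_prod_bool (fun i => bernoulliWeight (u i))]
  simp only [sum_bernoulliWeight, Finset.prod_const_one]

/-- Compare with `exp (y * n)` and use `exp t ≤ 1 + t + t ^ 2` for `0 ≤ t ≤ 1`. It makes the
chi-square divergence linear in the number of differing coordinates. -/
theorem one_add_pow_sub_one_le {y : ℝ} (hy : 0 ≤ y) {n : ℕ} (hn : y * n ≤ 1) :
    (1 + y) ^ n - 1 ≤ 2 * (y * n) := by
  have h1 : (1 + y) ^ n ≤ Real.exp (y * n) := by
    rw [mul_comm, Real.exp_nat_mul]
    gcongr
    linarith [Real.add_one_le_exp y]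
  have h2 : 0 ≤ y * n := by positivity
  have h3 := Real.abs_exp_sub_one_sub_id_le (x := y * n) (by rw [abs_of_nonneg h2]; exact hn)
  have h4 := (abs_le.mp h3).2
  nlinarith

/-- Change of measure between two product Bernoulli laws that differ in the coordinates `s`, where
the means are `1 / 2` and `1 / 2 + d`. -/
theorem sum_prod_bernoulliWeight_mul_le {ι : Type*} [Fintype ι] [DecidableEq ι] (s : Finset ι)
    (u v : ι → ℝ) (d : ℝ) (hu0 : ∀ i, 0 ≤ u i) (hu1 : ∀ i, u i ≤ 1)
    (hv0 : ∀ i, 0 ≤ v i) (hv1 : ∀ i, v i ≤ 1)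
    (hne : ∀ i ∉ s, v i = u i) (hu : ∀ i ∈ s, u i = 1 / 2) (hv : ∀ i ∈ s, v i = 1 / 2 + d)
    (φ : (ι → Bool) → ℝ) (M : ℝ) (hφ0 : ∀ x, 0 ≤ φ x) (hφM : ∀ x, φ x ≤ M) :
    ∑ x : ι → Bool, (∏ i, bernoulliWeight (v i) (x i)) * φ x ≤
      ∑ x : ι → Bool, (∏ i, bernoulliWeight (u i) (x i)) * φ x +
        M * (1 / 16 + 32 * d ^ 2 * s.card) := by
  have hM : 0 ≤ M := (hφ0 fun _ => true).trans (hφM _)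
  have hU : ∀ x : ι → Bool, 0 ≤ ∏ i, bernoulliWeight (u i) (x i) := fun x =>
    Finset.prod_nonneg fun i _ => bernoulliWeight_nonneg (hu0 i) (hu1 i) _
  have hV : ∀ x : ι → Bool, 0 ≤ ∏ i, bernoulliWeight (v i) (x i) := fun x =>
    Finset.prod_nonneg fun i _ => bernoulliWeight_nonneg (hv0 i) (hv1 i) _
  by_cases hbig : 4 * d ^ 2 * s.card ≤ 1
  -- The likelihood ratio of one coordinate, `(1 / 2 ± d) / (1 / 2)` on `s`.
  · let l : ι → Bool → ℝ := fun i b => if i ∈ s then (if b then 1 + 2 * d else 1 - 2 * d) else 1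
    have hvl : ∀ i b, bernoulliWeight (v i) b = bernoulliWeight (u i) b * l i b := by
      intro i b
      by_cases hi : i ∈ s
      · cases b <;> simp [bernoulliWeight, l, hi, hu i hi, hv i hi] <;> ring
      · simp [l, hi, hne i hi]
    have hl2 : ∀ i, ∑ b, bernoulliWeight (u i) b * l i b ^ 2 =
        if i ∈ s then 1 + 4 * d ^ 2 else 1 := by
      intro i
      by_cases hi : i ∈ s
      · simp [bernoulliWeight, l, hi, hu i hi]; ring
      · simp [bernoulliWeight, l, hi]
    have hprod : ∀ x : ι → Bool, ∏ i, bernoulliWeight (v i) (x i) =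
        (∏ i, bernoulliWeight (u i) (x i)) * ∏ i, l i (x i) := by
      intro x
      rw [← Finset.prod_mul_distrib]
      exact Finset.prod_congr rfl fun i _ => hvl i _
    have hsq : ∑ x : ι → Bool, (∏ i, bernoulliWeight (u i) (x i)) * (∏ i, l i (x i)) ^ 2 =
        (1 + 4 * d ^ 2) ^ s.card := by
      have : ∀ x : ι → Bool, (∏ i, bernoulliWeight (u i) (x i)) * (∏ i, l i (x i)) ^ 2 =
          ∏ i, (bernoulliWeight (u i) (x i) * l i (x i) ^ 2) := by
        intro x
        rw [← Finset.prod_pow, ← Finset.prod_mul_distrib]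
      rw [Finset.sum_congr rfl fun x _ => this x,
        sum_prod_bool (fun i b => bernoulliWeight (u i) b * l i b ^ 2)]
      simp only [hl2]
      simp
    have hchi : ∑ x : ι → Bool, (∏ i, bernoulliWeight (u i) (x i)) * (∏ i, l i (x i) - 1) ^ 2 =
        (1 + 4 * d ^ 2) ^ s.card - 1 := by
      have h1 := sum_prod_bernoulliWeight u
      have h2 := sum_prod_bernoulliWeight v
      simp only [hprod] at h2
      have : ∀ x : ι → Bool, (∏ i, bernoulliWeight (u i) (x i)) * (∏ i, l i (x i) - 1) ^ 2 =
          (∏ i, bernoulliWeight (u i) (x i)) * (∏ i, l i (x i)) ^ 2 -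
          2 * ((∏ i, bernoulliWeight (u i) (x i)) * (∏ i, l i (x i))) +
          ∏ i, bernoulliWeight (u i) (x i) := fun x => by ring
      rw [Finset.sum_congr rfl fun x _ => this x, Finset.sum_add_distrib,
        Finset.sum_sub_distrib, ← Finset.mul_sum, h1, h2, hsq]
      ring
    have hpow := one_add_pow_sub_one_le (y := 4 * d ^ 2) (by positivity) hbig
    have hterm : ∀ x : ι → Bool, (∏ i, bernoulliWeight (v i) (x i)) * φ x ≤
        (∏ i, bernoulliWeight (u i) (x i)) * φ x +
        M * (1 / 16 * (∏ i, bernoulliWeight (u i) (x i)) +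
          4 * ((∏ i, bernoulliWeight (u i) (x i)) * (∏ i, l i (x i) - 1) ^ 2)) := by
      intro x
      rw [hprod x]
      set U := ∏ i, bernoulliWeight (u i) (x i)
      set L := ∏ i, l i (x i)
      -- This is `(2 * (L - 1) - 1 / 4) ^ 2 ≥ 0`. Together with the divergence bound `8 * d ^ 2 *
      -- s.card` it yields the constant `32`.
      have hamgm : L - 1 ≤ 1 / 16 + 4 * (L - 1) ^ 2 := by nlinarith [sq_nonneg (L - 1 - 1 / 8)]
      have hR : 0 ≤ 1 / 16 + 4 * (L - 1) ^ 2 := by positivity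
      have h1 : φ x * (L - 1) ≤ M * (1 / 16 + 4 * (L - 1) ^ 2) :=
        (mul_le_mul_of_nonneg_left hamgm (hφ0 x)).trans
          (mul_le_mul_of_nonneg_right (hφM x) hR)
      have h2 := mul_le_mul_of_nonneg_left h1 (hU x)
      linarith
    refine (Finset.sum_le_sum fun x _ => hterm x).trans ?_
    rw [Finset.sum_add_distrib, ← Finset.mul_sum, Finset.sum_add_distrib, ← Finset.mul_sum,
      ← Finset.mul_sum, hchi, sum_prod_bernoulliWeight]
    have := mul_le_mul_of_nonneg_left hpow hM
    linarith
  -- Here the error term already exceeds `M`, which bounds the left side.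
  · have h1 : ∑ x : ι → Bool, (∏ i, bernoulliWeight (v i) (x i)) * φ x ≤ M := by
      calc _ ≤ ∑ x : ι → Bool, (∏ i, bernoulliWeight (v i) (x i)) * M :=
            Finset.sum_le_sum fun x _ => mul_le_mul_of_nonneg_left (hφM x) (hV x)
        _ = M := by rw [← Finset.sum_mul, sum_prod_bernoulliWeight, one_mul]
    have h2 : 0 ≤ ∑ x : ι → Bool, (∏ i, bernoulliWeight (u i) (x i)) * φ x :=
      Finset.sum_nonneg fun x _ => mul_nonneg (hU x) (hφ0 x)
    have h3 : M * 1 ≤ M * (1 / 16 + 32 * d ^ 2 * s.card) := by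
      gcongr
      linarith
    linarith

/-! ### Games with uniform transitions and Bernoulli rewards -/

noncomputable section

/-- The rewards `1` and `0`. -/
def bernoulliPoint (x : Bool) : Set.Icc (0 : ℝ) 1 := if x then 1 else 0

/-- The Bernoulli law with mean `q` on the unit interval. -/
def bernoulliLaw (q : Set.Icc (0 : ℝ) 1) : ProbabilityMeasure (Set.Icc (0 : ℝ) 1) :=
  ⟨∑ x : Bool, ENNReal.ofReal (bernoulliWeight q x) • Measure.dirac (bernoulliPoint x), ⟨by
    have h0 : ∀ x, 0 ≤ bernoulliWeight q x := bernoulliWeight_nonneg q.2.1 q.2.2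
    simp only [Measure.coe_finsetSum, Finset.sum_apply, Measure.smul_apply, measure_univ,
      smul_eq_mul, mul_one]
    rw [← ENNReal.ofReal_sum_of_nonneg fun x _ => h0 x, sum_bernoulliWeight, ENNReal.ofReal_one]⟩⟩

theorem coe_bernoulliLaw (q : Set.Icc (0 : ℝ) 1) :
    (bernoulliLaw q : Measure (Set.Icc (0 : ℝ) 1)) =
      ∑ x : Bool, ENNReal.ofReal (bernoulliWeight q x) • Measure.dirac (bernoulliPoint x) := rfl

theorem integral_bernoulliLaw (q : Set.Icc (0 : ℝ) 1) :
    ∫ x, (x : ℝ) ∂(bernoulliLaw q : Measure (Set.Icc (0 : ℝ) 1)) = q := by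
  rw [coe_bernoulliLaw, integral_finsetSum_measure]
  · simp [bernoulliWeight, bernoulliPoint, integral_smul_measure, ENNReal.toReal_ofReal q.2.1]
  · intro i _
    exact (integrable_dirac (by simp)).smul_measure (by simp)

/-- A product of Bernoulli laws is a finite mixture of point masses. -/
theorem pi_bernoulliLaw {ι : Type*} [Fintype ι] [DecidableEq ι] (q : ι → Set.Icc (0 : ℝ) 1) :
    Measure.pi (fun i => (bernoulliLaw (q i) : Measure (Set.Icc (0 : ℝ) 1))) =
      ∑ x : ι → Bool, ENNReal.ofReal (∏ i, bernoulliWeight (q i) (x i)) •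
        Measure.dirac (fun i => bernoulliPoint (x i)) := by
  refine Measure.pi_eq fun s hs => ?_
  have h0 : ∀ i x, 0 ≤ bernoulliWeight (q i) x := fun i =>
    bernoulliWeight_nonneg (q i).2.1 (q i).2.2
  simp only [coe_bernoulliLaw, Measure.coe_finsetSum, Finset.sum_apply, Measure.smul_apply,
    smul_eq_mul, Measure.dirac_apply' _ (MeasurableSet.univ_pi hs),
    Measure.dirac_apply' _ (hs _)]
  rw [Fintype.prod_sum]
  refine Finset.sum_congr rfl fun x _ => ?_
  rw [Finset.prod_mul_distrib, ENNReal.ofReal_prod_of_nonneg fun i _ => h0 i _]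
  congr 1
  classical
  by_cases h : ∀ i, bernoulliPoint (x i) ∈ s i
  · simp [Set.indicator, h]
  · obtain ⟨j, hj⟩ := not_forall.mp h
    rw [Finset.prod_eq_zero (Finset.mem_univ j) (by simp [hj])]
    simpa [Set.indicator] using h

variable {H S A B K : ℕ}

/-- The game in which the next state is always uniform and all rewards are Bernoulli. -/
def uniformGame [NeZero S] (q : Fin H → Fin S → Fin A → Fin B → Set.Icc (0 : ℝ) 1) :
    MarkovGame H S A B where
  trans _ _ _ _ := ⟨fun _ => (S : ℝ)⁻¹, fun _ => by positivity, by
    simp [NeZero.ne S]⟩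
  reward h s a b := bernoulliLaw (q h s a b)

@[simp]
theorem meanReward_uniformGame [NeZero S] (q : Fin H → Fin S → Fin A → Fin B → Set.Icc (0 : ℝ) 1)
    (h : Fin H) (s : Fin S) (a : Fin A) (b : Fin B) :
    meanReward (uniformGame q) h s a b = q h s a b :=
  integral_bernoulliLaw _

theorem episodeProb_nonneg (G : MarkovGame H S A B) (s₁ : Fin S) (π : JointPolicy H S A B)
    (τ : Episode H S A B) : 0 ≤ episodeProb G s₁ π τ :=
  mul_nonneg (by split_ifs <;> norm_num) (Finset.prod_nonneg fun h _ =>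
    mul_nonneg ((π _ _ _).2.1 _) ((G.trans _ _ _ _).2.1 _))

theorem datasetProb_nonneg (G : MarkovGame H S A B) (s₁ : Fin S)
    (alg : RewardFreeAlgorithm K H S A B) (D : Fin K → Episode H S A B) :
    0 ≤ datasetProb G s₁ alg D :=
  Finset.prod_nonneg fun _ _ => episodeProb_nonneg _ _ _ _

section Uniform

variable [NeZero S] (q : Fin H → Fin S → Fin A → Fin B → Set.Icc (0 : ℝ) 1) (s₁ : Fin S)

/-- In a game with uniform transitions the law of the states does not depend on the policy. -/
theorem sum_episodeProb_mul (π : JointPolicy H S A B) (F : (Fin (H + 1) → Fin S) → ℝ) :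
    ∑ τ, episodeProb (uniformGame q) s₁ π τ * F τ.1 =
      ∑ σ : Fin (H + 1) → Fin S, (if σ 0 = s₁ then 1 else 0) * (S : ℝ)⁻¹ ^ H * F σ := by
  rw [Fintype.sum_prod_type]
  refine Finset.sum_congr rfl fun σ _ => ?_
  -- For fixed states the action probabilities sum to one, from the last step backwards.
  have h1 := sum_prod_sequential H
    (fun (h : Fin H) (d : Fin h → Fin A × Fin B) z =>
      (π h (fun i => (σ ⟨i, by omega⟩, d i)) (σ h.castSucc)).1 z) (fun _ => 1)
    (fun k d => (π k _ _).2.2)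
  rw [Finset.prod_const_one] at h1
  have h2 : ∀ z : Fin H → Fin A × Fin B, episodeProb (uniformGame q) s₁ π (σ, z) =
      (if σ 0 = s₁ then 1 else 0) * (S : ℝ)⁻¹ ^ H *
        ∏ h, (π h (pastOf (σ, z) h) (σ h.castSucc)).1 (z h) := by
    intro z
    simp only [episodeProb, uniformGame, Finset.prod_mul_distrib, Finset.prod_const,
      Finset.card_univ, Fintype.card_fin]
    ring
  calc _ = ∑ z : Fin H → Fin A × Fin B, (if σ 0 = s₁ then 1 else 0) * (S : ℝ)⁻¹ ^ H * F σ *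
        ∏ h, (π h (pastOf (σ, z) h) (σ h.castSucc)).1 (z h) :=
        Finset.sum_congr rfl fun z _ => by rw [h2]; ring
    _ = (if σ 0 = s₁ then 1 else 0) * (S : ℝ)⁻¹ ^ H * F σ * 1 := by
        rw [← h1, Finset.mul_sum]
        rfl
    _ = _ := mul_one _

-- The states are independent, with a point mass at time `0` and uniform laws afterwards, so
-- expectations of products factorize.
omit [NeZero S] in
theorem sum_states_prod (w : Fin (H + 1) → Fin S → ℝ) :
    ∑ σ : Fin (H + 1) → Fin S, (if σ 0 = s₁ then 1 else 0) * (S : ℝ)⁻¹ ^ H * ∏ i, w i (σ i) =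
      w 0 s₁ * ∏ i : Fin H, ((S : ℝ)⁻¹ * ∑ t, w i.succ t) := by
  let v : Fin (H + 1) → Fin S → ℝ :=
    Fin.cons (fun t => (if t = s₁ then 1 else 0) * w 0 t) (fun i t => (S : ℝ)⁻¹ * w i.succ t)
  have h : ∀ σ : Fin (H + 1) → Fin S,
      (if σ 0 = s₁ then 1 else 0) * (S : ℝ)⁻¹ ^ H * ∏ i, w i (σ i) = ∏ i, v i (σ i) := by
    intro σ
    rw [Fin.prod_univ_succ, Fin.prod_univ_succ (fun i => v i (σ i))]
    simp only [v, Fin.cons_zero, Fin.cons_succ, Finset.prod_mul_distrib, Finset.prod_const,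
      Finset.card_univ, Fintype.card_fin]
    ring
  rw [Finset.sum_congr rfl fun σ _ => h σ, ← Fintype.prod_sum, Fin.prod_univ_succ]
  simp [v, Finset.mul_sum]

theorem sum_episodeProb (π : JointPolicy H S A B) :
    ∑ τ, episodeProb (uniformGame q) s₁ π τ = 1 := by
  have h1 := sum_episodeProb_mul q s₁ π (fun _ => 1)
  have h2 := sum_states_prod (H := H) s₁ (fun _ _ => 1)
  have hS : (S : ℝ) ≠ 0 := NeZero.ne _
  simp only [mul_one, Finset.prod_const_one, Finset.sum_const, Finset.card_univ,
    Fintype.card_fin, nsmul_eq_mul, inv_mul_cancel₀ hS] at h1 h2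
  rw [h1, h2]

/-- The steps at which the state is uniformly distributed. -/
def uniformSteps (H S : ℕ) : Finset (Fin H) := {h | h.1 ≠ 0 ∨ S = 1}

theorem sum_episodeProb_mul_indicator (π : JointPolicy H S A B) {h : Fin H}
    (hh : h ∈ uniformSteps H S) (s : Fin S) :
    ∑ τ, episodeProb (uniformGame q) s₁ π τ * (if τ.1 h.castSucc = s then 1 else 0) =
      (S : ℝ)⁻¹ := by
  rw [sum_episodeProb_mul q s₁ π (fun σ => if σ h.castSucc = s then 1 else 0)]
  have hS : (S : ℝ) ≠ 0 := NeZero.ne _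
  have h2 := sum_states_prod (H := H) s₁
    (fun i t => if i = h.castSucc then (if t = s then 1 else 0) else 1)
  simp only [Finset.prod_ite_eq', Finset.mem_univ, if_true] at h2
  rw [h2]
  -- The initial state is deterministic, hence uniform only if `S = 1`.
  rcases Fin.eq_zero_or_eq_succ h.castSucc with h0 | ⟨j, hj⟩
  · have h1 : S = 1 := by
      simp only [uniformSteps, Finset.mem_filter, Finset.mem_univ, true_and] at hh
      rcases hh with hh | hh
      · exact absurd (congrArg Fin.val h0) hh
      · exact hh
    subst h1
    simp [h0, Subsingleton.elim s₁ s, (Fin.succ_ne_zero _)]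
  · have : ∀ i : Fin H, (S : ℝ)⁻¹ * ∑ t : Fin S, (if i.succ = j.succ then
        (if t = s then (1 : ℝ) else 0) else 1) = if i = j then (S : ℝ)⁻¹ else 1 := by
      intro i
      by_cases hi : i = j
      · simp [hi]
      · simp [hi, hS]
    rw [hj]
    simp only [this]
    simp [(Fin.succ_ne_zero _).symm]

theorem sum_datasetProb (alg : RewardFreeAlgorithm K H S A B) :
    ∑ D, datasetProb (uniformGame q) s₁ alg D = 1 := by
  have := sum_prod_sequential K
    (fun k d τ => episodeProb (uniformGame q) s₁ (alg.explore k d) τ) (fun _ => 1)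
    (fun k d => sum_episodeProb q s₁ _)
  rwa [Finset.prod_const_one] at this

/-- Adaptive exploration cannot steer the states: the indicator changes only the factor of episode
`k`, whose sum is `S⁻¹` whatever the earlier episodes were. -/
theorem sum_datasetProb_mul_indicator (alg : RewardFreeAlgorithm K H S A B) (k : Fin K)
    {h : Fin H} (hh : h ∈ uniformSteps H S) (s : Fin S) :
    ∑ D, datasetProb (uniformGame q) s₁ alg D *
      (if (D k).1 h.castSucc = s then 1 else 0) = (S : ℝ)⁻¹ := by
  have := sum_prod_sequential K
    (fun j d τ => episodeProb (uniformGame q) s₁ (alg.explore j d) τ *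
      (if j = k then (if τ.1 h.castSucc = s then 1 else 0) else 1))
    (fun j => if j = k then (S : ℝ)⁻¹ else 1)
    (fun j d => by
      by_cases hj : j = k
      · simp only [hj, if_true]
        exact sum_episodeProb_mul_indicator q s₁ _ hh s
      · simp only [hj, if_false, mul_one]
        exact sum_episodeProb q s₁ _)
  simp only [Finset.prod_mul_distrib, Finset.prod_ite_eq', Finset.mem_univ, if_true] at this
  exact this

/-- The probability of the binary rewards `x`, given the transitions `D`. -/
def rewardWeight (m : Fin H → Fin S → Fin A → Fin B → ℝ) (D : Fin K → Episode H S A B)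
    (x : Fin K × Fin H → Bool) : ℝ :=
  ∏ kh, bernoulliWeight
    (m kh.2 ((D kh.1).1 kh.2.castSucc) ((D kh.1).2 kh.2).1 ((D kh.1).2 kh.2).2) (x kh)

/-- The output law given the transitions `D` and the binary rewards `x`. -/
def outputKernel (alg : RewardFreeAlgorithm K H S A B) (D : Fin K → Episode H S A B)
    (x : Fin K × Fin H → Bool) : Measure (MaxPolicy H S A B × MinPolicy H S A B) :=
  alg.plan D (fun kh => bernoulliPoint (x kh))

instance (alg : RewardFreeAlgorithm K H S A B) (D : Fin K → Episode H S A B)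
    (x : Fin K × Fin H → Bool) : IsProbabilityMeasure (outputKernel alg D x) :=
  (alg.plan_markov D).isProbabilityMeasure _

/-- With Bernoulli rewards the reward vector is a finite mixture of point masses, which turns the
output law into a finite sum. -/
theorem outputLaw_uniformGame (alg : RewardFreeAlgorithm K H S A B)
    {E : Set (MaxPolicy H S A B × MinPolicy H S A B)} (hE : MeasurableSet E) :
    outputLaw (uniformGame q) s₁ alg E =
      ENNReal.ofReal (∑ D, datasetProb (uniformGame q) s₁ alg D *
        ∑ x, rewardWeight (fun h s a b => (q h s a b : ℝ)) D x * (outputKernel alg D x).real E) := by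
  have hW : ∀ (D : Fin K → Episode H S A B) x,
      0 ≤ rewardWeight (fun h s a b => (q h s a b : ℝ)) D x := fun D x =>
    Finset.prod_nonneg fun kh _ => bernoulliWeight_nonneg (q _ _ _ _).2.1 (q _ _ _ _).2.2 _
  have hP := datasetProb_nonneg (uniformGame q) s₁ alg
  have hterm : ∀ D x, 0 ≤ rewardWeight (fun h s a b => (q h s a b : ℝ)) D x *
      (outputKernel alg D x).real E := fun D x => mul_nonneg (hW D x) measureReal_nonneg
  rw [ENNReal.ofReal_sum_of_nonneg fun D _ =>
    mul_nonneg (hP D) (Finset.sum_nonneg fun x _ => hterm D x)]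
  simp only [outputLaw, Measure.coe_finsetSum, Finset.sum_apply, Measure.smul_apply, smul_eq_mul]
  refine Finset.sum_congr rfl fun D _ => ?_
  rw [ENNReal.ofReal_mul (hP D), ENNReal.ofReal_sum_of_nonneg fun x _ => hterm D x,
    Measure.bind_apply hE (Kernel.aemeasurable _)]
  congr 1
  have hlaw : rewardLaw (uniformGame q) D = _ := pi_bernoulliLaw fun kh : Fin K × Fin H =>
    q kh.2 ((D kh.1).1 kh.2.castSucc) ((D kh.1).2 kh.2).1 ((D kh.1).2 kh.2).2
  rw [hlaw, lintegral_finsetSum_measure]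
  refine Finset.sum_congr rfl fun x _ => ?_
  rw [lintegral_smul_measure, lintegral_dirac' _ (Kernel.measurable_coe _ hE),
    ENNReal.ofReal_mul (hW D x)]
  rw [ofReal_measureReal]
  rfl

end Uniform

end

/-! ### Expectations over transitions and binary rewards -/

noncomputable section

variable {H S A B K : ℕ}

section Expectation

variable [NeZero S] (s₁ : Fin S) (alg : RewardFreeAlgorithm K H S A B)

/-- The law of the transitions in a game with uniform transitions. -/
def uniformDatasetProb (D : Fin K → Episode H S A B) : ℝ :=
  datasetProb (uniformGame fun _ _ _ _ => 0) s₁ alg D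

/-- The expectation of a function of the transitions and of the binary rewards. -/
def dataExpectation (m : Fin H → Fin S → Fin A → Fin B → ℝ)
    (f : (Fin K → Episode H S A B) → (Fin K × Fin H → Bool) → ℝ) : ℝ :=
  ∑ D, uniformDatasetProb s₁ alg D * ∑ x, rewardWeight m D x * f D x

variable {m : Fin H → Fin S → Fin A → Fin B → ℝ}

theorem uniformDatasetProb_nonneg (D : Fin K → Episode H S A B) :
    0 ≤ uniformDatasetProb s₁ alg D := datasetProb_nonneg _ _ _ _

theorem sum_uniformDatasetProb : ∑ D, uniformDatasetProb s₁ alg D = 1 := sum_datasetProb _ _ _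

omit [NeZero S] in
theorem sum_rewardWeight (m : Fin H → Fin S → Fin A → Fin B → ℝ) (D : Fin K → Episode H S A B) :
    ∑ x, rewardWeight m D x = 1 := sum_prod_bernoulliWeight _

omit [NeZero S] in
theorem rewardWeight_nonneg (hm : ∀ h s a b, m h s a b ∈ Set.Icc (0 : ℝ) 1)
    (D : Fin K → Episode H S A B) (x : Fin K × Fin H → Bool) : 0 ≤ rewardWeight m D x :=
  Finset.prod_nonneg fun _ _ => bernoulliWeight_nonneg (hm _ _ _ _).1 (hm _ _ _ _).2 _

theorem dataExpectation_mono (hm : ∀ h s a b, m h s a b ∈ Set.Icc (0 : ℝ) 1)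
    {f g : (Fin K → Episode H S A B) → (Fin K × Fin H → Bool) → ℝ}
    (hfg : ∀ D x, f D x ≤ g D x) : dataExpectation s₁ alg m f ≤ dataExpectation s₁ alg m g :=
  Finset.sum_le_sum fun D _ => mul_le_mul_of_nonneg_left
    (Finset.sum_le_sum fun x _ => mul_le_mul_of_nonneg_left (hfg D x) (rewardWeight_nonneg hm D x))
    (uniformDatasetProb_nonneg s₁ alg D)

theorem dataExpectation_const (c : ℝ) : dataExpectation s₁ alg m (fun _ _ => c) = c := by
  simp only [dataExpectation, ← Finset.sum_mul, sum_rewardWeight, one_mul,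
    sum_uniformDatasetProb]

theorem dataExpectation_sub (f g : (Fin K → Episode H S A B) → (Fin K × Fin H → Bool) → ℝ) :
    dataExpectation s₁ alg m (fun D x => f D x - g D x) =
      dataExpectation s₁ alg m f - dataExpectation s₁ alg m g := by
  simp only [dataExpectation, mul_sub, Finset.sum_sub_distrib]

theorem dataExpectation_const_mul (c : ℝ)
    (f : (Fin K → Episode H S A B) → (Fin K × Fin H → Bool) → ℝ) :
    dataExpectation s₁ alg m (fun D x => c * f D x) = c * dataExpectation s₁ alg m f := by
  simp only [dataExpectation, Finset.mul_sum]
  exact Finset.sum_congr rfl fun D _ => Finset.sum_congr rfl fun x _ => by ring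

theorem dataExpectation_sum {ι : Type*} (t : Finset ι)
    (f : ι → (Fin K → Episode H S A B) → (Fin K × Fin H → Bool) → ℝ) :
    dataExpectation s₁ alg m (fun D x => ∑ i ∈ t, f i D x) =
      ∑ i ∈ t, dataExpectation s₁ alg m (f i) := by
  simp only [dataExpectation, Finset.mul_sum]
  refine (Finset.sum_congr rfl fun D _ => ?_).trans Finset.sum_comm
  exact Finset.sum_comm

end Expectation

/-! ### Hidden arms and the failure of guessing -/

section Planted

variable {α β : Type*} [Fintype α] [Fintype β] [DecidableEq α] [DecidableEq β]
  (e : α × β ≃ Fin A × Fin B)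

/-- Mean rewards with a hidden arm in a hidden context: outside of the context `ctx (h, s)` the
mean is `other`, inside it is `1 / 2`, shifted by `d (h, s)` for the arm `arm (h, s)`. -/
def plantedMean (other : ℝ) (d : Fin H × Fin S → ℝ) (arm : Fin H × Fin S → α)
    (ctx : Fin H × Fin S → β) (h : Fin H) (s : Fin S) (a : Fin A) (b : Fin B) : ℝ :=
  if (e.symm (a, b)).2 ≠ ctx (h, s) then other
  else if (e.symm (a, b)).1 = arm (h, s) then 1 / 2 + d (h, s) else 1 / 2

omit [Fintype α] [Fintype β] in
theorem plantedMean_mem {other : ℝ} (ho : other ∈ Set.Icc (0 : ℝ) 1) {d : Fin H × Fin S → ℝ}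
    (hd : ∀ i, |d i| ≤ 1 / 2) (arm : Fin H × Fin S → α) (ctx : Fin H × Fin S → β)
    (h : Fin H) (s : Fin S) (a : Fin A) (b : Fin B) :
    plantedMean e other d arm ctx h s a b ∈ Set.Icc (0 : ℝ) 1 := by
  unfold plantedMean
  have := abs_le.mp (hd (h, s))
  split_ifs
  · exact ho
  · constructor <;> linarith
  · norm_num

-- Without a bonus at `i` the rewards carry no information on the arm there.
omit [Fintype α] [Fintype β] in
theorem plantedMean_update_arm (other : ℝ) {d : Fin H × Fin S → ℝ} {i : Fin H × Fin S}
    (hd : d i = 0) (arm : Fin H × Fin S → α) (a' : α) (ctx : Fin H × Fin S → β) :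
    plantedMean e other d (Function.update arm i a') ctx = plantedMean e other d arm ctx := by
  funext h s a b
  unfold plantedMean
  by_cases hi : (h, s) = i
  · subst hi; simp [hd]
  · simp [Function.update_of_ne hi]

/-- How often the data visit the pair `e z` in the state and step `i`. -/
def visits (D : Fin K → Episode H S A B) (i : Fin H × Fin S) (z : α × β) :
    Finset (Fin K × Fin H) :=
  {kh | kh.2 = i.1 ∧ (D kh.1).1 kh.2.castSucc = i.2 ∧ e.symm ((D kh.1).2 kh.2) = z}

theorem sum_card_visits (D : Fin K → Episode H S A B) (i : Fin H × Fin S) :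
    ∑ b : β, ∑ a : α, ((visits e D i (a, b)).card : ℝ) =
      ∑ k : Fin K, if (D k).1 i.1.castSucc = i.2 then 1 else 0 := by
  rw [Finset.sum_comm, ← Fintype.sum_prod_type (fun z => ((visits e D i z).card : ℝ))]
  simp only [visits, Finset.card_filter, Nat.cast_sum, Fintype.sum_prod_type (α₁ := Fin K)]
  rw [Finset.sum_comm]
  refine Finset.sum_congr rfl fun k _ => ?_
  rw [Finset.sum_comm, Finset.sum_eq_single i.1]
  · by_cases h : (D k).1 i.1.castSucc = i.2
    · simp only [h, true_and, if_true, Nat.cast_ite, Nat.cast_one, Nat.cast_zero]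
      rw [Finset.sum_ite_eq]
      simp
    · simp [h]
  · intro h _ hh
    simp [hh]
  · simp

-- The bonus at `i` affects only the rewards collected at visits of its hidden pair, so these are
-- the differing coordinates in the change of measure.
omit [Fintype α] [Fintype β] in
theorem sum_rewardWeight_mul_le {other : ℝ} (ho : other ∈ Set.Icc (0 : ℝ) 1) {d : ℝ}
    (hd : |d| ≤ 1 / 2) (arm : Fin H × Fin S → α) (ctx : Fin H × Fin S → β)
    (i : Fin H × Fin S) (D : Fin K → Episode H S A B) (φ : (Fin K × Fin H → Bool) → ℝ) (M : ℝ)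
    (hφ0 : ∀ x, 0 ≤ φ x) (hφM : ∀ x, φ x ≤ M) :
    ∑ x, rewardWeight (plantedMean e other (fun _ => d) arm ctx) D x * φ x ≤
      ∑ x, rewardWeight (plantedMean e other (Function.update (fun _ => d) i 0) arm ctx) D x * φ x +
        M * (1 / 16 + 32 * d ^ 2 * (visits e D i (arm i, ctx i)).card) := by
  have hd' : ∀ j, |Function.update (fun _ => d) i 0 j| ≤ 1 / 2 := by
    intro j
    by_cases hj : j = i
    · subst hj; simp
    · simpa [Function.update_of_ne hj] using hd
  have hu := plantedMean_mem e ho hd' arm ctx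
  have hv := plantedMean_mem e ho (fun _ => hd) arm ctx
  refine sum_prod_bernoulliWeight_mul_le (visits e D i (arm i, ctx i)) _ _ d
    (fun _ => (hu _ _ _ _).1) (fun _ => (hu _ _ _ _).2)
    (fun _ => (hv _ _ _ _).1) (fun _ => (hv _ _ _ _).2) ?_ ?_ ?_ φ M hφ0 hφM
  · intro kh hkh
    by_cases hj : (kh.2, (D kh.1).1 kh.2.castSucc) = i
    · simp only [visits, Finset.mem_filter, Finset.mem_univ, true_and, ← hj] at hkh
      rw [Prod.ext_iff] at hkh
      unfold plantedMean
      simp only [Prod.mk.eta, ← hj]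
      by_cases h2 : (e.symm ((D kh.1).2 kh.2)).2 = ctx (kh.2, (D kh.1).1 kh.2.castSucc)
      · have h1 : (e.symm ((D kh.1).2 kh.2)).1 ≠ arm (kh.2, (D kh.1).1 kh.2.castSucc) :=
          fun h1 => hkh ⟨h1, h2⟩
        simp [h1]
      · simp [h2]
    · simp [plantedMean, Function.update_of_ne hj]
  · intro kh hkh
    simp only [visits, Finset.mem_filter, Finset.mem_univ, true_and] at hkh
    obtain ⟨h1, h2, h3⟩ := hkh
    have hi : (kh.2, (D kh.1).1 kh.2.castSucc) = i := Prod.ext h1 h2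
    simp [plantedMean, hi, h3]
  · intro kh hkh
    simp only [visits, Finset.mem_filter, Finset.mem_univ, true_and] at hkh
    obtain ⟨h1, h2, h3⟩ := hkh
    have hi : (kh.2, (D kh.1).1 kh.2.castSucc) = i := Prod.ext h1 h2
    simp [plantedMean, hi, h3]

/-- For given transitions, a guess of the arm at `i` that is made from the rewards and the contexts
is hardly better than a blind one, on average over all arms and contexts. -/
theorem sum_sum_rewardWeight_mul_le [Nonempty α] [Nonempty β] {other : ℝ}
    (ho : other ∈ Set.Icc (0 : ℝ) 1) {d : ℝ} (hd : |d| ≤ 1 / 2) (i : Fin H × Fin S)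
    (D : Fin K → Episode H S A B)
    (γ : (Fin K × Fin H → Bool) → (Fin H × Fin S → β) → α → ℝ) (M : ℝ)
    (hγ0 : ∀ x c a, 0 ≤ γ x c a) (hγ1 : ∀ x c, ∑ a, γ x c a = M) :
    ∑ ctx : Fin H × Fin S → β, ∑ arm : Fin H × Fin S → α,
      ∑ x, rewardWeight (plantedMean e other (fun _ => d) arm ctx) D x * γ x ctx (arm i) ≤
    (Fintype.card (Fin H × Fin S → α) * Fintype.card (Fin H × Fin S → β)) *
      (M * ((Fintype.card α : ℝ)⁻¹ + 1 / 16 + 32 * d ^ 2 *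
        ((∑ k : Fin K, if (D k).1 i.1.castSucc = i.2 then 1 else 0) /
          (Fintype.card α * Fintype.card β)))) := by
  have hα : (Fintype.card α : ℝ) ≠ 0 := by exact_mod_cast Fintype.card_ne_zero
  have hβ : (Fintype.card β : ℝ) ≠ 0 := by exact_mod_cast Fintype.card_ne_zero
  set Cα := (Fintype.card (Fin H × Fin S → α) : ℝ)
  set Cβ := (Fintype.card (Fin H × Fin S → β) : ℝ)
  have hγM : ∀ x c a, γ x c a ≤ M := fun x c a => by
    rw [← hγ1 x c]
    exact Finset.single_le_sum (fun a _ => hγ0 x c a) (Finset.mem_univ a)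
  -- Once the bonus at `i` is removed, resampling `arm i` leaves the law of the data unchanged, and
  -- the guesses of all arms sum to `M`.
  have hblind : ∀ ctx : Fin H × Fin S → β, ∑ arm : Fin H × Fin S → α,
      ∑ x, rewardWeight (plantedMean e other (Function.update (fun _ => d) i 0) arm ctx) D x *
        γ x ctx (arm i) = Cα * (M * (Fintype.card α : ℝ)⁻¹) := by
    intro ctx
    have h := card_mul_sum_eq_sum_sum_update i (fun arm : Fin H × Fin S → α =>
      ∑ x, rewardWeight (plantedMean e other (Function.update (fun _ => d) i 0) arm ctx) D x *
        γ x ctx (arm i))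
    simp only [plantedMean_update_arm e other (Function.update_self i (0 : ℝ) (fun _ => d)),
      Function.update_self] at h
    have h2 : ∀ arm : Fin H × Fin S → α, ∑ a, ∑ x,
        rewardWeight (plantedMean e other (Function.update (fun _ => d) i 0) arm ctx) D x *
          γ x ctx a = M := by
      intro arm
      rw [Finset.sum_comm]
      simp only [← Finset.mul_sum, hγ1]
      rw [← Finset.sum_mul, sum_rewardWeight, one_mul]
    rw [Finset.sum_congr rfl fun arm _ => h2 arm, Finset.sum_const, Finset.card_univ,
      nsmul_eq_mul] at h
    field_simp
    linarith
  -- Averaging over the hidden pair at `i` divides the visits of the state evenly among all pairs.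
  have hvis : ∑ ctx : Fin H × Fin S → β, ∑ arm : Fin H × Fin S → α,
      ((visits e D i (arm i, ctx i)).card : ℝ) = Cα * Cβ *
        ((∑ k : Fin K, if (D k).1 i.1.castSucc = i.2 then 1 else 0) /
          (Fintype.card α * Fintype.card β)) := by
    have h1 := card_mul_sum_eval i (fun b => ∑ arm : Fin H × Fin S → α,
      ((visits e D i (arm i, b)).card : ℝ))
    have h2 := fun b => card_mul_sum_eval i (fun a => ((visits e D i (a, b)).card : ℝ))
    rw [← sum_card_visits e D i]
    have h3 : (Fintype.card α : ℝ) * ∑ b, ∑ arm : Fin H × Fin S → α,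
        ((visits e D i (arm i, b)).card : ℝ) =
        Cα * ∑ b, ∑ a, ((visits e D i (a, b)).card : ℝ) := by
      rw [Finset.mul_sum, Finset.mul_sum]
      exact Finset.sum_congr rfl fun b _ => h2 b
    field_simp
    linear_combination (Fintype.card α : ℝ) * h1 + Cβ * h3
  calc _ ≤ ∑ ctx : Fin H × Fin S → β, ∑ arm : Fin H × Fin S → α,
        (∑ x, rewardWeight (plantedMean e other (Function.update (fun _ => d) i 0) arm ctx) D x *
          γ x ctx (arm i) +
        M * (1 / 16 + 32 * d ^ 2 * (visits e D i (arm i, ctx i)).card)) :=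
        Finset.sum_le_sum fun ctx _ => Finset.sum_le_sum fun arm _ =>
          sum_rewardWeight_mul_le e ho hd arm ctx i D (fun x => γ x ctx (arm i)) M
            (fun x => hγ0 x ctx _) (fun x => hγM x ctx _)
    _ = _ := by
      simp only [Finset.sum_add_distrib, hblind, mul_add, ← Finset.mul_sum, hvis,
        Finset.sum_const, Finset.card_univ, nsmul_eq_mul]
      ring

/-- The guess of the arm at a uniformly visited pair is hardly better than a blind one if the
number of episodes is small. -/
theorem sum_sum_dataExpectation_le [NeZero S] [Nonempty β] (s₁ : Fin S)
    (alg : RewardFreeAlgorithm K H S A B) {other : ℝ}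
    (ho : other ∈ Set.Icc (0 : ℝ) 1) {d : ℝ} (hd : |d| ≤ 1 / 2) (hα : 2 ≤ Fintype.card α)
    (hK : 512 * d ^ 2 * K ≤ S * (Fintype.card α * Fintype.card β))
    {h : Fin H} (hh : h ∈ uniformSteps H S) (s : Fin S)
    (γ : (Fin K → Episode H S A B) → (Fin K × Fin H → Bool) → (Fin H × Fin S → β) → α → ℝ)
    (hγ0 : ∀ D x c a, 0 ≤ γ D x c a) (hγ1 : ∀ D x c, ∑ a, γ D x c a = (S : ℝ)⁻¹) :
    ∑ ctx : Fin H × Fin S → β, ∑ arm : Fin H × Fin S → α,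
      dataExpectation s₁ alg (plantedMean e other (fun _ => d) arm ctx)
        (fun D x => γ D x ctx (arm (h, s))) ≤
    (Fintype.card (Fin H × Fin S → α) * Fintype.card (Fin H × Fin S → β)) *
      ((S : ℝ)⁻¹ * (5 / 8)) := by
  have : Nonempty α := Fintype.card_pos_iff.mp (by omega)
  have hS : (0 : ℝ) < S := by exact_mod_cast NeZero.pos S
  have hα' : (2 : ℝ) ≤ Fintype.card α := by exact_mod_cast hα
  have hβ' : (0 : ℝ) < Fintype.card β := by exact_mod_cast Fintype.card_pos
  set Cα := (Fintype.card (Fin H × Fin S → α) : ℝ)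
  set Cβ := (Fintype.card (Fin H × Fin S → β) : ℝ)
  have hC : 0 ≤ Cα * Cβ := by positivity
  simp only [dataExpectation]
  rw [Finset.sum_congr rfl fun ctx _ => Finset.sum_comm, Finset.sum_comm]
  simp only [← Finset.mul_sum]
  calc _ ≤ ∑ D, uniformDatasetProb s₁ alg D * (Cα * Cβ * ((S : ℝ)⁻¹ *
        ((Fintype.card α : ℝ)⁻¹ + 1 / 16 + 32 * d ^ 2 *
        ((∑ k : Fin K, if (D k).1 h.castSucc = s then 1 else 0) /
          (Fintype.card α * Fintype.card β))))) :=
        Finset.sum_le_sum fun D _ => mul_le_mul_of_nonneg_left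
          (sum_sum_rewardWeight_mul_le e ho hd (h, s) D (γ D) _ (hγ0 D) (hγ1 D))
          (uniformDatasetProb_nonneg s₁ alg D)
    _ = Cα * Cβ * ((S : ℝ)⁻¹ * ((Fintype.card α : ℝ)⁻¹ + 1 / 16 + 32 * d ^ 2 *
        ((K * (S : ℝ)⁻¹) / (Fintype.card α * Fintype.card β)))) := by
      have h1 : ∑ D, uniformDatasetProb s₁ alg D *
          ∑ k : Fin K, (if (D k).1 h.castSucc = s then (1 : ℝ) else 0) = K * (S : ℝ)⁻¹ := by
        simp only [Finset.mul_sum]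
        have hk : ∀ k, ∑ D, uniformDatasetProb s₁ alg D *
            (if (D k).1 h.castSucc = s then (1 : ℝ) else 0) = (S : ℝ)⁻¹ := fun k =>
          sum_datasetProb_mul_indicator (fun _ _ _ _ => 0) s₁ alg k hh s
        rw [Finset.sum_comm, Finset.sum_congr rfl fun k _ => hk k]
        simp
      have h2 := sum_uniformDatasetProb s₁ alg
      rw [← h1]
      have : ∀ D, uniformDatasetProb s₁ alg D * (Cα * Cβ * ((S : ℝ)⁻¹ *
          ((Fintype.card α : ℝ)⁻¹ + 1 / 16 + 32 * d ^ 2 *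
          ((∑ k : Fin K, if (D k).1 h.castSucc = s then 1 else 0) /
            (Fintype.card α * Fintype.card β))))) =
          (Cα * Cβ * (S : ℝ)⁻¹ * ((Fintype.card α : ℝ)⁻¹ + 1 / 16)) *
            uniformDatasetProb s₁ alg D +
          (Cα * Cβ * (S : ℝ)⁻¹ * (32 * d ^ 2) / (Fintype.card α * Fintype.card β)) *
            (uniformDatasetProb s₁ alg D *
              ∑ k : Fin K, if (D k).1 h.castSucc = s then 1 else 0) := fun D => by ring
      rw [Finset.sum_congr rfl fun D _ => this D, Finset.sum_add_distrib, ← Finset.mul_sum,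
        ← Finset.mul_sum, h2]
      ring
    _ ≤ _ := by
      -- Blind guess, change of measure and visits: `1 / 2 + 1 / 16 + 1 / 16 = 5 / 8`. The factor
      -- `512 = 32 * 16` in `hK` serves the last term.
      have h1 : (Fintype.card α : ℝ)⁻¹ ≤ 1 / 2 := by
        rw [inv_le_comm₀ (by linarith) (by norm_num)]; linarith
      have h2 : 32 * d ^ 2 * ((K * (S : ℝ)⁻¹) / (Fintype.card α * Fintype.card β)) ≤ 1 / 16 := by
        have h3 : 32 * d ^ 2 * ((K * (S : ℝ)⁻¹) / (Fintype.card α * Fintype.card β)) =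
            (32 * d ^ 2 * K) / (S * (Fintype.card α * Fintype.card β)) := by
          field_simp
        rw [h3, div_le_iff₀ (by positivity)]
        linarith
      gcongr
      linarith

end Planted

end

/-! ### Missed arms, and a game in which many are missed -/

noncomputable section

variable {H S A B K : ℕ} {α β : Type*} [Fintype α] [Fintype β] [DecidableEq α] [DecidableEq β]
  (e : α × β ≃ Fin A × Fin B)

/-- The game with uniform transitions, Bernoulli rewards and a hidden arm in a hidden context at
every step and state. -/
def plantedGame [NeZero S] {other : ℝ} (ho : other ∈ Set.Icc (0 : ℝ) 1) {d : ℝ}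
    (hd : |d| ≤ 1 / 2) (arm : Fin H × Fin S → α) (ctx : Fin H × Fin S → β) : MarkovGame H S A B :=
  uniformGame fun h s a b =>
    ⟨plantedMean e other (fun _ => d) arm ctx h s a b, plantedMean_mem e ho (fun _ => hd) _ _ _ _ _ _⟩

/-- The probability that the state `s` is visited at step `h` and that the arm `a` is played there,
in a game with uniform transitions. -/
def armProb [NeZero S] (s₁ : Fin S) (π : JointPolicy H S A B) (h : Fin H) (s : Fin S) (a : α) : ℝ :=
  ∑ τ, episodeProb (uniformGame fun _ _ _ _ => 0) s₁ π τ *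
    if τ.1 h.castSucc = s ∧ (e.symm (τ.2 h)).1 = a then 1 else 0

variable [NeZero S] (s₁ : Fin S)

omit [Fintype α] [Fintype β] [DecidableEq β] in
theorem armProb_nonneg (π : JointPolicy H S A B) (h : Fin H) (s : Fin S) (a : α) :
    0 ≤ armProb e s₁ π h s a :=
  Finset.sum_nonneg fun τ _ => mul_nonneg (episodeProb_nonneg _ _ _ _)
    (by split_ifs <;> norm_num)

omit [Fintype β] [DecidableEq β] in
theorem sum_armProb (π : JointPolicy H S A B) {h : Fin H} (hh : h ∈ uniformSteps H S)
    (s : Fin S) : ∑ a, armProb e s₁ π h s a = (S : ℝ)⁻¹ := by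
  rw [← sum_episodeProb_mul_indicator (fun _ _ _ _ => 0) s₁ π hh s]
  simp only [armProb]
  rw [Finset.sum_comm]
  refine Finset.sum_congr rfl fun τ _ => ?_
  rw [← Finset.mul_sum]
  congr 1
  by_cases h1 : τ.1 h.castSucc = s <;> simp [h1]

omit [Fintype β] [DecidableEq β] in
theorem armProb_le (π : JointPolicy H S A B) {h : Fin H} (hh : h ∈ uniformSteps H S)
    (s : Fin S) (a : α) : armProb e s₁ π h s a ≤ (S : ℝ)⁻¹ := by
  rw [← sum_armProb e s₁ π hh s]
  exact Finset.single_le_sum (fun a _ => armProb_nonneg e s₁ π h s a) (Finset.mem_univ a)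

/-- The expected number of uniform steps at which the hidden arm is missed. -/
def missCount (π : JointPolicy H S A B) (arm : Fin H × Fin S → α) : ℝ :=
  ∑ h ∈ uniformSteps H S, (1 - ∑ s, armProb e s₁ π h s (arm (h, s)))

omit [Fintype α] [Fintype β] [DecidableEq β] in
theorem missCount_le (π : JointPolicy H S A B) (arm : Fin H × Fin S → α) :
    missCount e s₁ π arm ≤ (uniformSteps H S).card := by
  rw [Finset.cast_card]
  exact Finset.sum_le_sum fun h _ => by
    have := Finset.sum_nonneg fun (s : Fin S) (_ : s ∈ Finset.univ) =>
      armProb_nonneg e s₁ π h s (arm (h, s))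
    linarith

omit [Fintype α] [Fintype β] [DecidableEq β] in
theorem sum_armProb_state (π : JointPolicy H S A B) (arm : Fin H × Fin S → α) (h : Fin H) :
    ∑ s, armProb e s₁ π h s (arm (h, s)) =
      ∑ τ, episodeProb (uniformGame fun _ _ _ _ => 0) s₁ π τ *
        if (e.symm (τ.2 h)).1 = arm (h, τ.1 h.castSucc) then 1 else 0 := by
  simp only [armProb]
  rw [Finset.sum_comm]
  refine Finset.sum_congr rfl fun τ _ => ?_
  rw [← Finset.mul_sum]
  congr 1
  rw [Finset.sum_eq_single (τ.1 h.castSucc)]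
  · simp
  · intro s _ hs
    simp [hs.symm]
  · simp

omit [Fintype α] [Fintype β] [DecidableEq β] in
/-- The missed steps are at most all missed steps of the episode. -/
theorem missCount_le_sum (π : JointPolicy H S A B) (arm : Fin H × Fin S → α)
    (q : Fin H → Fin S → Fin A → Fin B → Set.Icc (0 : ℝ) 1) :
    missCount e s₁ π arm ≤ ∑ τ, episodeProb (uniformGame q) s₁ π τ *
      ∑ h, (1 - if (e.symm (τ.2 h)).1 = arm (h, τ.1 h.castSucc) then 1 else 0) := by
  have h1 : ∀ h, (1 - ∑ s, armProb e s₁ π h s (arm (h, s))) =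
      ∑ τ, episodeProb (uniformGame q) s₁ π τ *
        (1 - if (e.symm (τ.2 h)).1 = arm (h, τ.1 h.castSucc) then 1 else 0) := by
    intro h
    simp only [mul_one_sub, Finset.sum_sub_distrib, sum_episodeProb, sum_armProb_state]
    rfl
  simp only [missCount, h1, Finset.mul_sum]
  rw [Finset.sum_comm (s := (Finset.univ : Finset (Episode H S A B)))]
  refine Finset.sum_le_sum_of_subset_of_nonneg (Finset.subset_univ _) fun h _ _ =>
    Finset.sum_nonneg fun τ _ => mul_nonneg (episodeProb_nonneg _ _ _ _) ?_
  split_ifs <;> norm_num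

omit [Fintype α] [Fintype β] [DecidableEq β] in
theorem measurable_armProb {Ω : Type*} [MeasurableSpace Ω] {π : Ω → JointPolicy H S A B}
    (hπ : ∀ h p s z, Measurable fun ω => (π ω h p s).1 z) (h : Fin H) (s : Fin S) (a : α) :
    Measurable fun ω => armProb e s₁ (π ω) h s a := by
  refine Finset.measurable_sum _ fun τ _ => Measurable.mul_const ?_ _
  exact (Finset.measurable_prod _ fun h _ => (hπ _ _ _ _).mul_const _).const_mul _

omit [Fintype α] [Fintype β] [DecidableEq β] in
theorem measurable_missCount {Ω : Type*} [MeasurableSpace Ω] {π : Ω → JointPolicy H S A B}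
    (hπ : ∀ h p s z, Measurable fun ω => (π ω h p s).1 z) (arm : Fin H × Fin S → α) :
    Measurable fun ω => missCount e s₁ (π ω) arm :=
  Finset.measurable_sum _ fun _ _ => (Finset.measurable_sum _ fun _ _ =>
    measurable_armProb e s₁ hπ _ _ _).const_sub 1

omit [Fintype β] [DecidableEq β] in
theorem integrable_armProb {Ω : Type*} [MeasurableSpace Ω] (Q : Measure Ω) [IsFiniteMeasure Q]
    {π : Ω → JointPolicy H S A B} (hπ : ∀ h p s z, Measurable fun ω => (π ω h p s).1 z)
    {h : Fin H} (hh : h ∈ uniformSteps H S) (s : Fin S) (a : α) :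
    Integrable (fun ω => armProb e s₁ (π ω) h s a) Q :=
  Integrable.of_bound (measurable_armProb e s₁ hπ h s a).aestronglyMeasurable (S : ℝ)⁻¹
    (Filter.Eventually.of_forall fun ω => by
      rw [Real.norm_of_nonneg (armProb_nonneg e s₁ _ h s a)]
      exact armProb_le e s₁ _ hh s a)

omit [Fintype β] [DecidableEq β] in
theorem integral_missCount {Ω : Type*} [MeasurableSpace Ω] (Q : Measure Ω) [IsProbabilityMeasure Q]
    {π : Ω → JointPolicy H S A B} (hπ : ∀ h p s z, Measurable fun ω => (π ω h p s).1 z)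
    (arm : Fin H × Fin S → α) :
    Integrable (fun ω => missCount e s₁ (π ω) arm) Q ∧
    ∫ ω, missCount e s₁ (π ω) arm ∂Q = ∑ h ∈ uniformSteps H S,
      (1 - ∑ s, ∫ ω, armProb e s₁ (π ω) h s (arm (h, s)) ∂Q) := by
  have hs : ∀ h ∈ uniformSteps H S, Integrable
      (fun ω => ∑ s, armProb e s₁ (π ω) h s (arm (h, s))) Q := fun h hh =>
    integrable_finsetSum _ fun s _ => integrable_armProb e s₁ Q hπ hh s _
  have h1 : ∀ h ∈ uniformSteps H S, Integrable
      (fun ω => 1 - ∑ s, armProb e s₁ (π ω) h s (arm (h, s))) Q := fun h hh =>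
    (integrable_const 1).sub (hs h hh)
  refine ⟨integrable_finsetSum _ h1, ?_⟩
  simp only [missCount]
  rw [integral_finsetSum _ h1]
  refine Finset.sum_congr rfl fun h hh => ?_
  rw [integral_sub (integrable_const 1) (hs h hh),
    integral_finsetSum _ fun s _ => integrable_armProb e s₁ Q hπ hh s _]
  simp

omit [Fintype β] [DecidableEq β] in
/-- If the hidden arm is missed often on average, then it is missed often with large probability. -/
theorem integral_missCount_le {Ω : Type*} [MeasurableSpace Ω] (Q : Measure Ω)
    [IsProbabilityMeasure Q] {π : Ω → JointPolicy H S A B}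
    (hπ : ∀ h p s z, Measurable fun ω => (π ω h p s).1 z) (arm : Fin H × Fin S → α) :
    ∫ ω, missCount e s₁ (π ω) arm ∂Q ≤ (uniformSteps H S).card *
      (Q.real {ω | ((uniformSteps H S).card : ℝ) / 8 ≤ missCount e s₁ (π ω) arm} + 1 / 8) := by
  set N : ℝ := ((uniformSteps H S).card : ℝ)
  set E := {ω | N / 8 ≤ missCount e s₁ (π ω) arm}
  have hN : 0 ≤ N := Nat.cast_nonneg _
  have hE : MeasurableSet E := measurableSet_le measurable_const (measurable_missCount e s₁ hπ arm)
  have hind : Integrable (E.indicator (fun _ => (1 : ℝ))) Q := (integrable_const 1).indicator hE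
  have hint : Integrable (fun ω => N * (E.indicator (fun _ => (1 : ℝ)) ω + 1 / 8)) Q :=
    (hind.add (integrable_const _)).const_mul _
  -- Reverse Markov inequality: the count is at most `N` on `E` and below `N / 8` off it.
  calc _ ≤ ∫ ω, N * (E.indicator (fun _ => (1 : ℝ)) ω + 1 / 8) ∂Q := by
        refine integral_mono (integral_missCount e s₁ Q hπ arm).1 hint fun ω => ?_
        by_cases hω : ω ∈ E
        · simp only [Set.indicator_of_mem hω]
          have := missCount_le e s₁ (π ω) arm
          linarith
        · simp only [Set.indicator_of_notMem hω]
          have : missCount e s₁ (π ω) arm < N / 8 := not_le.mp hω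
          linarith
    _ = _ := by
        rw [integral_const_mul, integral_add hind (integrable_const _), integral_indicator_const _ hE]
        simp

-- Reward-freeness enters here: `datasetProb` involves only the transitions, so the law of `D` is
-- the same for all arms and contexts.
omit [Fintype α] [Fintype β] in
theorem outputLaw_plantedGame (alg : RewardFreeAlgorithm K H S A B)
    {other : ℝ} (ho : other ∈ Set.Icc (0 : ℝ) 1) {d : ℝ} (hd : |d| ≤ 1 / 2)
    (arm : Fin H × Fin S → α) (ctx : Fin H × Fin S → β)
    {E : Set (MaxPolicy H S A B × MinPolicy H S A B)} (hE : MeasurableSet E) :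
    outputLaw (plantedGame e ho hd arm ctx) s₁ alg E =
      ENNReal.ofReal (dataExpectation s₁ alg (plantedMean e other (fun _ => d) arm ctx)
        fun D x => (outputKernel alg D x).real E) :=
  outputLaw_uniformGame _ s₁ alg hE

/-- Some choice of arms and contexts makes the algorithm miss many arms. -/
theorem exists_plantedGame [Nonempty β] (alg : RewardFreeAlgorithm K H S A B)
    {other : ℝ} (ho : other ∈ Set.Icc (0 : ℝ) 1) {d : ℝ} (hd : |d| ≤ 1 / 2)
    (hα : 2 ≤ Fintype.card α) (hK : 512 * d ^ 2 * K ≤ S * (Fintype.card α * Fintype.card β))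
    (hsteps : (uniformSteps H S).Nonempty)
    (π : (Fin H × Fin S → β) → MaxPolicy H S A B × MinPolicy H S A B → JointPolicy H S A B)
    (hπ : ∀ ctx h p s z, Measurable fun ω => (π ctx ω h p s).1 z) :
    ∃ (arm : Fin H × Fin S → α) (ctx : Fin H × Fin S → β),
      1 / 4 ≤ outputLaw (plantedGame e ho hd arm ctx) s₁ alg
        {ω | ((uniformSteps H S).card : ℝ) / 8 ≤ missCount e s₁ (π ctx ω) arm} := by
  have : Nonempty α := Fintype.card_pos_iff.mp (by omega)
  have hS : (S : ℝ) ≠ 0 := NeZero.ne _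
  set N : ℝ := ((uniformSteps H S).card : ℝ) with hNdef
  have hN : 0 < N := Nat.cast_pos.mpr hsteps.card_pos
  -- The guess of the arm made by the output. It may use the contexts but not the arms.
  let γ : (Fin K → Episode H S A B) → (Fin K × Fin H → Bool) → (Fin H × Fin S → β) →
      Fin H → Fin S → α → ℝ := fun D x ctx h s a =>
    ∫ ω, armProb e s₁ (π ctx ω) h s a ∂(outputKernel alg D x)
  have hγ0 : ∀ D x ctx h s a, 0 ≤ γ D x ctx h s a := fun D x ctx h s a =>
    integral_nonneg fun ω => armProb_nonneg e s₁ _ h s a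
  have hγ1 : ∀ h ∈ uniformSteps H S, ∀ s D x ctx, ∑ a, γ D x ctx h s a = (S : ℝ)⁻¹ := by
    intro h hh s D x ctx
    simp only [γ]
    rw [← integral_finsetSum _ fun a _ => integrable_armProb e s₁ _ (hπ ctx) hh s a]
    simp [sum_armProb e s₁ _ hh s]
  let V : (Fin H × Fin S → β) → (Fin H × Fin S → α) → ℝ := fun ctx arm =>
    dataExpectation s₁ alg (plantedMean e other (fun _ => d) arm ctx) fun D x =>
      (outputKernel alg D x).real {ω | N / 8 ≤ missCount e s₁ (π ctx ω) arm}
  have hV : ∀ ctx arm, 7 / 8 * N - N * V ctx arm ≤ ∑ h ∈ uniformSteps H S, ∑ s,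
      dataExpectation s₁ alg (plantedMean e other (fun _ => d) arm ctx)
        (fun D x => γ D x ctx h s (arm (h, s))) := by
    intro ctx arm
    have h1 := dataExpectation_mono s₁ alg
      (plantedMean_mem e ho (d := fun _ : Fin H × Fin S => d) (fun _ => hd) arm ctx)
      (fun D x => integral_missCount_le e s₁ (outputKernel alg D x) (hπ ctx) arm)
    simp only [(integral_missCount e s₁ (outputKernel alg _ _) (hπ ctx) arm).2] at h1
    have h2 : ∀ D x, N * ((outputKernel alg D x).real
        {ω | N / 8 ≤ missCount e s₁ (π ctx ω) arm} + 1 / 8) =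
        N * (outputKernel alg D x).real {ω | N / 8 ≤ missCount e s₁ (π ctx ω) arm} - -(N / 8) :=
      fun D x => by ring
    simp only [← hNdef, h2] at h1
    rw [dataExpectation_sub, dataExpectation_const, dataExpectation_const_mul,
      dataExpectation_sum] at h1
    simp only [dataExpectation_sub, dataExpectation_const, dataExpectation_sum] at h1
    rw [Finset.sum_sub_distrib, ← Finset.cast_card, ← hNdef] at h1
    simp only [V, γ]
    linarith
  have hsum : ∑ ctx, ∑ arm, (7 / 8 * N - N * V ctx arm) ≤
      ∑ _ctx : Fin H × Fin S → β, ∑ _arm : Fin H × Fin S → α, 5 / 8 * N := by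
    calc _ ≤ ∑ ctx, ∑ arm, ∑ h ∈ uniformSteps H S, ∑ s,
          dataExpectation s₁ alg (plantedMean e other (fun _ => d) arm ctx)
            (fun D x => γ D x ctx h s (arm (h, s))) :=
          Finset.sum_le_sum fun ctx _ => Finset.sum_le_sum fun arm _ => hV ctx arm
      _ = ∑ h ∈ uniformSteps H S, ∑ s, ∑ ctx, ∑ arm,
          dataExpectation s₁ alg (plantedMean e other (fun _ => d) arm ctx)
            (fun D x => γ D x ctx h s (arm (h, s))) := by
          rw [Finset.sum_congr rfl fun ctx _ => Finset.sum_comm, Finset.sum_comm]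
          refine Finset.sum_congr rfl fun h _ => ?_
          rw [Finset.sum_congr rfl fun ctx _ => Finset.sum_comm, Finset.sum_comm]
      _ ≤ ∑ h ∈ uniformSteps H S, ∑ s : Fin S,
          ((Fintype.card (Fin H × Fin S → α) * Fintype.card (Fin H × Fin S → β)) *
            ((S : ℝ)⁻¹ * (5 / 8))) :=
          Finset.sum_le_sum fun h hh => Finset.sum_le_sum fun s _ =>
            sum_sum_dataExpectation_le e s₁ alg ho hd hα hK hh s
              (fun D x c a => γ D x c h s a) (fun D x c a => hγ0 D x c h s a) (hγ1 h hh s)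
      _ = _ := by
          simp only [Finset.sum_const, nsmul_eq_mul, Finset.card_univ, Fintype.card_fin]
          rw [← hNdef]
          field_simp
  obtain ⟨ctx, -, hctx⟩ := Finset.exists_le_of_sum_le Finset.univ_nonempty hsum
  obtain ⟨arm, -, harm⟩ := Finset.exists_le_of_sum_le Finset.univ_nonempty hctx
  refine ⟨arm, ctx, ?_⟩
  rw [outputLaw_plantedGame e s₁ alg ho hd arm ctx
    (measurableSet_le measurable_const (measurable_missCount e s₁ (hπ ctx) arm))]
  -- The selected game satisfies `7 / 8 * N - N * V ≤ 5 / 8 * N`.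
  have h1 : 1 / 4 ≤ V ctx arm := by
    by_contra hlt
    push Not at hlt
    nlinarith
  calc (1 / 4 : ENNReal) = ENNReal.ofReal (1 / 4) := by
        rw [ENNReal.ofReal_div_of_pos (by norm_num)]; simp
    _ ≤ _ := ENNReal.ofReal_le_ofReal h1

end

/-! ### From missed arms to the duality gap -/

noncomputable section

variable {H S A B : ℕ}

/-- The policy of the max-player that plays the action `f (h, s)` in state `s` at step `h`. -/
def playMax (f : Fin H × Fin S → Fin A) : MaxPolicy H S A B :=
  fun h _ s => ⟨Pi.single (f (h, s)) 1, single_mem_stdSimplex ℝ _⟩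

/-- The policy of the min-player that plays the action `f (h, s)` in state `s` at step `h`. -/
def playMin (f : Fin H × Fin S → Fin B) : MinPolicy H S A B :=
  fun h _ s => ⟨Pi.single (f (h, s)) 1, single_mem_stdSimplex ℝ _⟩

/-- Episodes with an action of probability zero have no weight. Against a deterministic player,
rewards thus need comparison only where that player follows the prescribed actions. -/
theorem sum_episodeProb_mul_le (G : MarkovGame H S A B) (s₁ : Fin S) (π : JointPolicy H S A B)
    {f g : Episode H S A B → ℝ}
    (hfg : ∀ τ, (∀ h, (π h (pastOf τ h) (τ.1 h.castSucc)).1 (τ.2 h) ≠ 0) → f τ ≤ g τ) :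
    ∑ τ, episodeProb G s₁ π τ * f τ ≤ ∑ τ, episodeProb G s₁ π τ * g τ := by
  refine Finset.sum_le_sum fun τ _ => ?_
  by_cases h : ∀ h, (π h (pastOf τ h) (τ.1 h.castSucc)).1 (τ.2 h) ≠ 0
  · exact mul_le_mul_of_nonneg_left (hfg τ h) (episodeProb_nonneg _ _ _ _)
  · push Not at h
    obtain ⟨h, hh⟩ := h
    have : episodeProb G s₁ π τ = 0 := by
      unfold episodeProb
      rw [Finset.prod_eq_zero (Finset.mem_univ h) (by rw [hh, zero_mul]), mul_zero]
    simp [this]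

theorem eq_of_prodPolicy_playMax {f : Fin H × Fin S → Fin A} {ν : MinPolicy H S A B} {h : Fin H}
    {p : Past S A B h} {s : Fin S} {z : Fin A × Fin B}
    (hz : (prodPolicy (playMax f) ν h p s).1 z ≠ 0) : z.1 = f (h, s) := by
  by_contra hne
  exact hz (by simp [prodPolicy, playMax, hne])

theorem eq_of_prodPolicy_playMin {f : Fin H × Fin S → Fin B} {μ : MaxPolicy H S A B} {h : Fin H}
    {p : Past S A B h} {s : Fin S} {z : Fin A × Fin B}
    (hz : (prodPolicy μ (playMin f) h p s).1 z ≠ 0) : z.2 = f (h, s) := by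
  by_contra hne
  exact hz (by simp [prodPolicy, playMin, hne])

section Gap

variable [NeZero S] (s₁ : Fin S)

theorem value_uniformGame_mem (q : Fin H → Fin S → Fin A → Fin B → Set.Icc (0 : ℝ) 1)
    (μ : MaxPolicy H S A B) (ν : MinPolicy H S A B) :
    value (uniformGame q) s₁ μ ν ∈ Set.Icc (0 : ℝ) H := by
  constructor
  · refine Finset.sum_nonneg fun τ _ => mul_nonneg (episodeProb_nonneg _ _ _ _)
      (Finset.sum_nonneg fun h _ => ?_)
    rw [meanReward_uniformGame]
    exact (q _ _ _ _).2.1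
  · calc value (uniformGame q) s₁ μ ν
        ≤ ∑ τ, episodeProb (uniformGame q) s₁ (prodPolicy μ ν) τ * H := by
          refine sum_episodeProb_mul_le _ _ _ fun τ _ => ?_
          calc _ ≤ ∑ _h : Fin H, (1 : ℝ) := Finset.sum_le_sum fun h _ => by
                rw [meanReward_uniformGame]
                exact (q _ _ _ _).2.2
            _ = H := by simp
      _ = H := by rw [← Finset.sum_mul, sum_episodeProb, one_mul]

/-- The bounds on the values make the real supremum and infimum genuine, so any pair of deviations
bounds the gap from below. -/
theorem value_sub_value_le_dualityGap
    (q : Fin H → Fin S → Fin A → Fin B → Set.Icc (0 : ℝ) 1)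
    (μ μ' : MaxPolicy H S A B) (ν ν' : MinPolicy H S A B) :
    value (uniformGame q) s₁ μ' ν - value (uniformGame q) s₁ μ ν' ≤
      dualityGap (uniformGame q) s₁ μ ν :=
  sub_le_sub
    (le_ciSup (f := fun μ' => value (uniformGame q) s₁ μ' ν)
      ⟨H, by rintro _ ⟨x, rfl⟩; exact (value_uniformGame_mem s₁ q _ _).2⟩ μ')
    (ciInf_le (f := fun ν' => value (uniformGame q) s₁ μ ν')
      ⟨0, by rintro _ ⟨x, rfl⟩; exact (value_uniformGame_mem s₁ q _ _).1⟩ ν')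

/-- A max-player who misses the hidden arms loses against the min-player who plays the context. -/
theorem mul_missCount_le_dualityGap_max (ho : (1 : ℝ) ∈ Set.Icc (0 : ℝ) 1) {d : ℝ} (hd0 : 0 ≤ d)
    (hd : |d| ≤ 1 / 2) (arm : Fin H × Fin S → Fin A) (ctx : Fin H × Fin S → Fin B)
    (μ : MaxPolicy H S A B) (ν : MinPolicy H S A B) :
    d * missCount (Equiv.refl (Fin A × Fin B)) s₁ (prodPolicy μ (playMin ctx)) arm ≤
      dualityGap (plantedGame (Equiv.refl (Fin A × Fin B)) ho hd arm ctx) s₁ μ ν := by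
  set q : Fin H → Fin S → Fin A → Fin B → Set.Icc (0 : ℝ) 1 := fun h s a b =>
    ⟨plantedMean (Equiv.refl (Fin A × Fin B)) 1 (fun _ => d) arm ctx h s a b,
      plantedMean_mem _ ho (fun _ => hd) _ _ _ _ _ _⟩ with hq
  have hd2 := (abs_le.mp hd).2
  -- The arms secure this against every `ν`: leaving the context only raises the reward to `1 ≥ 1 /
  -- 2 + d`.
  have h1 : H * (1 / 2 + d) ≤ value (uniformGame q) s₁ (playMax arm) ν := by
    calc H * (1 / 2 + d) = ∑ τ, episodeProb (uniformGame q) s₁ (prodPolicy (playMax arm) ν) τ *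
          ∑ _h : Fin H, (1 / 2 + d) := by
          rw [← Finset.sum_mul, sum_episodeProb]
          simp only [Finset.sum_const, Finset.card_univ, Fintype.card_fin, nsmul_eq_mul, one_mul]
      _ ≤ _ := by
          refine sum_episodeProb_mul_le _ _ _ fun τ hτ => Finset.sum_le_sum fun h _ => ?_
          have := eq_of_prodPolicy_playMax (hτ h)
          rw [meanReward_uniformGame]
          simp only [hq, plantedMean, Equiv.refl_symm, Equiv.refl_apply, this, if_true]
          split_ifs <;> linarith
  have h2 : value (uniformGame q) s₁ μ (playMin ctx) ≤
      H * (1 / 2 + d) - d * missCount (Equiv.refl (Fin A × Fin B)) s₁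
        (prodPolicy μ (playMin ctx)) arm := by
    have h3 := mul_le_mul_of_nonneg_left
      (missCount_le_sum (Equiv.refl (Fin A × Fin B)) s₁ (prodPolicy μ (playMin ctx)) arm q) hd0
    calc _ ≤ ∑ τ, episodeProb (uniformGame q) s₁ (prodPolicy μ (playMin ctx)) τ *
          (H * (1 / 2 + d) - d * ∑ h : Fin H,
            (1 - if (τ.2 h).1 = arm (h, τ.1 h.castSucc) then 1 else 0)) := by
          refine sum_episodeProb_mul_le _ _ _ fun τ hτ => ?_
          have h4 : (H : ℝ) * (1 / 2 + d) = ∑ _h : Fin H, (1 / 2 + d) := by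
            simp only [Finset.sum_const, Finset.card_univ, Fintype.card_fin, nsmul_eq_mul]
          rw [h4, Finset.mul_sum, ← Finset.sum_sub_distrib]
          refine Finset.sum_le_sum fun h _ => ?_
          have := eq_of_prodPolicy_playMin (hτ h)
          rw [meanReward_uniformGame]
          simp only [hq, plantedMean, Equiv.refl_symm, Equiv.refl_apply, this, ne_eq,
            not_true_eq_false, if_false]
          by_cases hc : (τ.2 h).1 = arm (h, τ.1 h.castSucc) <;>
            simp only [hc, if_true, if_false] <;> linarith
      _ = H * (1 / 2 + d) - d * ∑ τ, episodeProb (uniformGame q) s₁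
            (prodPolicy μ (playMin ctx)) τ *
          ∑ h : Fin H, (1 - if (τ.2 h).1 = arm (h, τ.1 h.castSucc) then 1 else 0) := by
          simp only [mul_sub, Finset.sum_sub_distrib, ← Finset.sum_mul, sum_episodeProb, one_mul,
            mul_left_comm _ d, ← Finset.mul_sum]
      _ ≤ _ := sub_le_sub_left h3 _
  exact le_trans (by linarith) (value_sub_value_le_dualityGap s₁ q μ (playMax arm) ν (playMin ctx))

/-- A min-player who misses the hidden arms loses against the max-player who plays the context. -/
theorem mul_missCount_le_dualityGap_min (ho : (0 : ℝ) ∈ Set.Icc (0 : ℝ) 1) {d : ℝ} (hd0 : 0 ≤ d)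
    (hd : |(-d)| ≤ 1 / 2) (arm : Fin H × Fin S → Fin B) (ctx : Fin H × Fin S → Fin A)
    (μ : MaxPolicy H S A B) (ν : MinPolicy H S A B) :
    d * missCount (Equiv.prodComm (Fin B) (Fin A)) s₁ (prodPolicy (playMax ctx) ν) arm ≤
      dualityGap (plantedGame (Equiv.prodComm (Fin B) (Fin A)) ho hd arm ctx) s₁ μ ν := by
  set q : Fin H → Fin S → Fin A → Fin B → Set.Icc (0 : ℝ) 1 := fun h s a b =>
    ⟨plantedMean (Equiv.prodComm (Fin B) (Fin A)) 0 (fun _ => -d) arm ctx h s a b,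
      plantedMean_mem _ ho (fun _ => hd) _ _ _ _ _ _⟩ with hq
  have hd2 := (abs_le.mp hd).1
  -- Mirror image: leaving the context lowers the reward to `0 ≤ 1 / 2 - d`.
  have h1 : value (uniformGame q) s₁ μ (playMin arm) ≤ H * (1 / 2 - d) := by
    calc _ ≤ ∑ τ, episodeProb (uniformGame q) s₁ (prodPolicy μ (playMin arm)) τ *
          ∑ _h : Fin H, (1 / 2 - d) := by
          refine sum_episodeProb_mul_le _ _ _ fun τ hτ => Finset.sum_le_sum fun h _ => ?_
          have := eq_of_prodPolicy_playMin (hτ h)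
          rw [meanReward_uniformGame]
          simp only [hq, plantedMean, Equiv.prodComm_symm, Equiv.prodComm_apply, Prod.swap_prod_mk,
            this, if_true]
          split_ifs <;> linarith
      _ = _ := by
          rw [← Finset.sum_mul, sum_episodeProb]
          simp only [Finset.sum_const, Finset.card_univ, Fintype.card_fin, nsmul_eq_mul, one_mul]
  have h2 : H * (1 / 2 - d) + d * missCount (Equiv.prodComm (Fin B) (Fin A)) s₁
        (prodPolicy (playMax ctx) ν) arm ≤ value (uniformGame q) s₁ (playMax ctx) ν := by
    have h3 := mul_le_mul_of_nonneg_left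
      (missCount_le_sum (Equiv.prodComm (Fin B) (Fin A)) s₁ (prodPolicy (playMax ctx) ν) arm q) hd0
    calc _ ≤ H * (1 / 2 - d) + d * ∑ τ, episodeProb (uniformGame q) s₁
            (prodPolicy (playMax ctx) ν) τ *
          ∑ h : Fin H, (1 - if (τ.2 h).2 = arm (h, τ.1 h.castSucc) then 1 else 0) :=
          add_le_add_right h3 _
      _ = ∑ τ, episodeProb (uniformGame q) s₁ (prodPolicy (playMax ctx) ν) τ *
          (H * (1 / 2 - d) + d * ∑ h : Fin H,
            (1 - if (τ.2 h).2 = arm (h, τ.1 h.castSucc) then 1 else 0)) := by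
          simp only [mul_add, Finset.sum_add_distrib, mul_left_comm _ d, ← Finset.mul_sum]
          rw [← Finset.sum_mul, sum_episodeProb, one_mul]
      _ ≤ _ := by
          refine sum_episodeProb_mul_le _ _ _ fun τ hτ => ?_
          have h4 : (H : ℝ) * (1 / 2 - d) = ∑ _h : Fin H, (1 / 2 - d) := by
            simp only [Finset.sum_const, Finset.card_univ, Fintype.card_fin, nsmul_eq_mul]
          rw [h4, Finset.mul_sum, ← Finset.sum_add_distrib]
          refine Finset.sum_le_sum fun h _ => ?_
          have := eq_of_prodPolicy_playMax (hτ h)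
          rw [meanReward_uniformGame]
          simp only [hq, plantedMean, Equiv.prodComm_symm, Equiv.prodComm_apply, Prod.swap_prod_mk,
            this, ne_eq, not_true_eq_false, if_false]
          by_cases hc : (τ.2 h).2 = arm (h, τ.1 h.castSucc) <;>
            simp only [hc, if_true, if_false] <;> linarith
  exact le_trans (by linarith) (value_sub_value_le_dualityGap s₁ q μ (playMax ctx) ν (playMin arm))

end Gap

theorem measurable_maxPolicy_apply (h : Fin H) (p : Past S A B h) (s : Fin S) (a : Fin A) :
    Measurable fun μ : MaxPolicy H S A B => (μ h p s).1 a := by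
  have h1 : Measurable fun μ : MaxPolicy H S A B => μ h p s :=
    (measurable_pi_apply s).comp ((measurable_pi_apply p).comp (measurable_pi_apply h))
  exact (measurable_pi_apply a).comp (measurable_subtype_coe.comp h1)

theorem measurable_minPolicy_apply (h : Fin H) (p : Past S A B h) (s : Fin S) (b : Fin B) :
    Measurable fun ν : MinPolicy H S A B => (ν h p s).1 b := by
  have h1 : Measurable fun ν : MinPolicy H S A B => ν h p s :=
    (measurable_pi_apply s).comp ((measurable_pi_apply p).comp (measurable_pi_apply h))
  exact (measurable_pi_apply b).comp (measurable_subtype_coe.comp h1)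

/-- Only the first step can fail to be uniform, and `H - 1 ≥ H / 2` for `2 ≤ H`. If `H = S = 1`, the
single step counts. -/
theorem le_two_mul_card_uniformSteps (h : 2 ≤ H ∨ H = 1 ∧ S = 1) :
    H ≤ 2 * (uniformSteps H S).card := by
  rcases h with h | ⟨rfl, rfl⟩
  · have hsub : Finset.univ.erase (⟨0, by omega⟩ : Fin H) ⊆ uniformSteps H S := by
      intro x hx
      rw [Finset.mem_erase] at hx
      simp only [uniformSteps, Finset.mem_filter, Finset.mem_univ, true_and]
      exact Or.inl fun h0 => hx.1 (Fin.ext h0)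
    have := Finset.card_le_card hsub
    rw [Finset.card_erase_of_mem (Finset.mem_univ _), Finset.card_univ, Fintype.card_fin] at this
    omega
  · simp [uniformSteps]

end

/-! ### The lower bound -/

theorem theorem4 :
    ∃ c : ℝ, 0 < c ∧
      ∀ (H S A B : ℕ) (s₁ : Fin S),
        2 ≤ A * B → (2 ≤ H ∨ (H = 1 ∧ S = 1)) →
        ∀ ε : ℝ, 0 < ε → ε ≤ c →
          ∃ family : Set (MarkovGame H S A B),
            ∀ (K : ℕ) (alg : RewardFreeAlgorithm K H S A B),
              (K : ℝ) ≤ c * (H : ℝ) ^ 2 * S * A * B / ε ^ 2 →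
              ∃ G ∈ family,
                1 / 4 ≤ outputLaw G s₁ alg {p | ε ≤ dualityGap G s₁ p.1 p.2} := by
  -- `131072 = 512 * 16 ^ 2`: the factor `512` of the sample condition times the `16 ^ 2` in `d ^
  -- 2`.
  refine ⟨1 / 131072, by norm_num, ?_⟩
  intro H S A B s₁ hAB hHS ε hε hεc
  have : NeZero S := ⟨by have := s₁.2; omega⟩
  have hcard := le_two_mul_card_uniformSteps hHS
  have hH : 0 < H := by omega
  have hsteps : (uniformSteps H S).Nonempty := Finset.card_pos.mp (by omega)
  have hH' : (0 : ℝ) < H := by exact_mod_cast hH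
  have hH1 : (1 : ℝ) ≤ H := by exact_mod_cast hH
  have hcard' : (H : ℝ) ≤ 2 * (uniformSteps H S).card := by exact_mod_cast hcard
  -- Missing an eighth of at least `H / 2` uniform steps then costs at least `d * H / 16 = ε`.
  set d : ℝ := 16 * ε / H with hd
  have hd0 : 0 ≤ d := by positivity
  have hd1 : d ≤ 1 / 2 := by
    rw [hd, div_le_iff₀ hH']
    linarith
  have habs : |d| ≤ 1 / 2 := by rwa [abs_of_nonneg hd0]
  have habs' : |(-d)| ≤ 1 / 2 := by rwa [abs_neg]
  have hgap : ∀ x : ℝ, ((uniformSteps H S).card : ℝ) / 8 ≤ x → ε ≤ d * x := by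
    intro x hx
    calc ε = d * (H / 2 / 8) := by rw [hd]; field_simp; norm_num
      _ ≤ d * x := mul_le_mul_of_nonneg_left (by linarith) hd0
  have hsamples : ∀ K : ℕ, (K : ℝ) ≤ 1 / 131072 * (H : ℝ) ^ 2 * S * A * B / ε ^ 2 →
      512 * d ^ 2 * (K : ℝ) ≤ S * (A * B) := by
    intro K hK
    calc 512 * d ^ 2 * (K : ℝ) ≤ 512 * d ^ 2 * (1 / 131072 * (H : ℝ) ^ 2 * S * A * B / ε ^ 2) := by
          gcongr
      _ = (S : ℝ) * (A * B) := by rw [hd]; field_simp; norm_num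
  have hA0 : 0 < A := Nat.pos_of_ne_zero fun h => by simp [h] at hAB
  have hB0 : 0 < B := Nat.pos_of_ne_zero fun h => by simp [h] at hAB
  by_cases hA : 2 ≤ A
  · have : Nonempty (Fin B) := ⟨⟨0, hB0⟩⟩
    have ho : (1 : ℝ) ∈ Set.Icc (0 : ℝ) 1 := by norm_num
    refine ⟨{G | ∃ arm ctx, G = plantedGame (Equiv.refl (Fin A × Fin B)) ho habs arm ctx}, ?_⟩
    intro K alg hK
    obtain ⟨arm, ctx, h⟩ := exists_plantedGame (Equiv.refl (Fin A × Fin B)) s₁ alg ho habs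
      (by simpa using hA) (by simpa using hsamples K hK) hsteps
      (fun ctx p => prodPolicy p.1 (playMin ctx))
      (fun ctx h p s z => ((measurable_maxPolicy_apply h p s z.1).comp measurable_fst).mul_const _)
    -- Monotonicity of the measure suffices, so measurability of the duality gap, a supremum over
    -- uncountably many policies, is not needed.
    refine ⟨_, ⟨arm, ctx, rfl⟩, h.trans (measure_mono fun p hp => ?_)⟩
    exact (hgap _ hp).trans (mul_missCount_le_dualityGap_max s₁ ho hd0 habs arm ctx p.1 p.2)
  · have : Nonempty (Fin A) := ⟨⟨0, hA0⟩⟩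
    have ho : (0 : ℝ) ∈ Set.Icc (0 : ℝ) 1 := by norm_num
    have hB : 2 ≤ B := by
      have : A = 1 := by omega
      subst this
      omega
    refine ⟨{G | ∃ arm ctx, G = plantedGame (Equiv.prodComm (Fin B) (Fin A)) ho habs' arm ctx}, ?_⟩
    intro K alg hK
    obtain ⟨arm, ctx, h⟩ := exists_plantedGame (Equiv.prodComm (Fin B) (Fin A)) s₁ alg ho habs'
      (by simpa using hB) (by simpa [mul_comm (B : ℝ)] using hsamples K hK) hsteps
      (fun ctx p => prodPolicy (playMax ctx) p.2)
      (fun ctx h p s z => ((measurable_minPolicy_apply h p s z.2).comp measurable_snd).const_mul _)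
    refine ⟨_, ⟨arm, ctx, rfl⟩, h.trans (measure_mono fun p hp => ?_)⟩
    exact (hgap _ hp).trans (mul_missCount_le_dualityGap_min s₁ ho hd0 habs' arm ctx p.1 p.2)
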